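/- A weighted graph is given by a finite vertex set $V$ partitioned into the vertices $V_{\max}$ of player Max and $V_{\min}$ of player Min, a set $E\subseteq V\times V$ of edges such that every vertex has a successor, and integer weights $\omega\colon E\to\mathbb Z$. A play is an infinite path $v_0v_1\cdots$. A strategy of a player maps every finite sequence of vertices ending in a vertex $v$ of that player to a successor of $v$. Two strategies $\sigma$ of Max and $\tau$ of Min determine a unique play from each vertex. For a payoff function on plays, with values in $\mathbb R\cup\{-\infty,+\infty\}$, the lower value of $v$ is $\sup_\sigma\inf_\tau$ and the upper value is $\inf_\tau\sup_\sigma$ of the payoff of that play. The value of $v$ exists if the two are equal, and is then their common value. In the mean-payoff game the payoff of $v_0v_1\cdots$ is $\liminf_{k\to\infty}\frac1k\sum_{i<k}\omega(v_i,v_{i+1})$. In the min-cost reachability (MCR) game with target set $T\subseteq V$, the payoff is $\sum_{i<k}\omega(v_i,v_{i+1})$, where $k$ is the least index with $v_k\in T$, and it is $+\infty$ if there is no such index. In every MCR game below, the only outgoing edge of each target vertex is a self loop of weight $0$. **Proposition.** 1. Consider an MCR game on a weighted graph $G$ in which no vertex has value $+\infty$. For every vertex $v$, the value of $v$ in the MCR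 game and its value in the mean-payoff game on the same graph $G$ exist, and the first one is $-\infty$ if and only if the second one is $<0$. 2. Conversely, there is a map, computable in polynomial time by a Turing machine (games being written as adjacency matrices with the weights in binary), that sends every mean-payoff game $\mathcal G$ to an MCR game $\mathcal G'$ with a single target vertex and without vertices of value $+\infty$, whose vertex set contains that of $\mathcal G$ (the vertices of $\mathcal G$ are the first vertices of $\mathcal G'$), such that for every vertex $v$ of $\mathcal G$ the values of $v$ in $\mathcal G$ and in $\mathcal G'$ exist, and the value of $v$ in $\mathcal G$ is $<0$ if and only if its value in $\mathcal G'$ is $-\infty$. -/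

import Mathlib

open Filter

namespace MCRGames

/-- The two players. -/
inductive Player where
  | max
  | min
  deriving DecidableEq

/-- A weighted graph on the vertex set `V`, whose vertices are partitioned between the two players.
`edge u v = none` means that `(u, v)` is not an edge, and `edge u v = some w` that it is an edge
of weight `w`. Every vertex has a successor. -/
structure WeightedGraph (V : Type*) where
  owner : V → Player
  edge : V → V → Option ℤ
  deadlockFree : ∀ u, ∃ v, (edge u v).isSome

namespace WeightedGraph

variable {V : Type*} (G : WeightedGraph V)

/-- `(u, v)` is an edge. -/
def IsEdge (u v : V) : Prop := (G.edge u v).isSome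

/-- The weight of the edge `(u, v)` (zero on pairs that are not edges). -/
def weight (u v : V) : ℤ := (G.edge u v).getD 0

/-- A strategy of player `p`: `next h v` is the successor chosen after the sequence of vertices `h`
followed by `v`. The values at the vertices `v` of the opponent are never used. -/
structure Strategy (p : Player) where
  next : List V → V → V
  legal : ∀ h v, G.owner v = p → G.IsEdge v (next h v)

variable {G} in
/-- After `k` moves from `v` under the two strategies: the vertices `v₀, …, vₖ₋₁` visited before,
and the current vertex `vₖ`. -/
def position (σ : G.Strategy .max) (τ : G.Strategy .min) (v : V) : ℕ → List V × V
  | 0 => ([], v)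
  | k + 1 =>
    let q := position σ τ v k
    (q.1 ++ [q.2],
      match G.owner q.2 with
      | .max => σ.next q.1 q.2
      | .min => τ.next q.1 q.2)

variable {G} in
/-- The unique play from `v` that conforms to both strategies. -/
def outcome (σ : G.Strategy .max) (τ : G.Strategy .min) (v : V) (k : ℕ) : V :=
  (position σ τ v k).2

/-- The total payoff of the prefix `π 0, …, π k` of a play. -/
def prefixPayoff (π : ℕ → V) (k : ℕ) : ℤ :=
  ∑ i ∈ Finset.range k, G.weight (π i) (π (i + 1))

/-- The mean payoff of a play: the inferior limit of the average weights of its prefixes. -/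
noncomputable def meanPayoff (π : ℕ → V) : EReal :=
  liminf (fun k : ℕ => (((G.prefixPayoff π k : ℝ) / (k : ℝ) : ℝ) : EReal)) atTop

open Classical in
/-- The min-cost reachability payoff: the sum of the weights up to the first visit of `T`,
and `+∞` if the play avoids `T`. -/
noncomputable def mcrPayoff (T : Set V) (π : ℕ → V) : EReal :=
  if h : ∃ k, π k ∈ T then ((G.prefixPayoff π (Nat.find h) : ℝ) : EReal) else ⊤

/-- The lower value of `v` in the game on `G` with the given payoff. -/
noncomputable def lowerValue (payoff : (ℕ → V) → EReal) (v : V) : EReal :=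
  ⨆ σ : G.Strategy .max, ⨅ τ : G.Strategy .min, payoff (outcome σ τ v)

/-- The upper value of `v` in the game on `G` with the given payoff. -/
noncomputable def upperValue (payoff : (ℕ → V) → EReal) (v : V) : EReal :=
  ⨅ τ : G.Strategy .min, ⨆ σ : G.Strategy .max, payoff (outcome σ τ v)

/-- `v` has a value, and this value is `x`: the lower and the upper value of `v` are both `x`. -/
def HasValue (payoff : (ℕ → V) → EReal) (v : V) (x : EReal) : Prop :=
  G.lowerValue payoff v = x ∧ G.upperValue payoff v = x

/-- The only outgoing edge of every vertex of `T` is a self loop of weight `0`. -/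
def IsSink (T : Set V) : Prop :=
  ∀ t ∈ T, G.edge t t = some 0 ∧ ∀ v, v ≠ t → G.edge t v = none

end WeightedGraph

/-- A mean-payoff game, as the input of an algorithm: a weighted graph with vertices
`0, …, n - 1`. -/
structure MPInstance where
  n : ℕ
  graph : WeightedGraph (Fin n)

/-- A min-cost reachability game with one target vertex, as the output of an algorithm. -/
structure MCRInstance where
  n : ℕ
  graph : WeightedGraph (Fin n)
  target : Fin n

/-- The alphabet in which games are written. -/
inductive Letter where
  | maxVertex
  | minVertex
  | targetMark
  | noEdge
  | plus
  | minus
  | bit (b : Bool)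
  deriving DecidableEq, Fintype

/-- The symbol that opens the row of a vertex. -/
def encodePlayer : Player → Letter
  | .max => .maxVertex
  | .min => .minVertex

/-- An entry of the weighted adjacency matrix: either the absence of an edge, or the sign of the
weight followed by the binary digits of its absolute value, the least significant first. -/
def encodeEntry : Option ℤ → List Letter
  | none => [.noEdge]
  | some w => (if 0 ≤ w then Letter.plus else Letter.minus) :: w.natAbs.bits.map Letter.bit

/-- The weighted adjacency matrix, row by row. The row of a vertex starts with its owner, and with
a mark if the vertex is marked. -/
def encodeGraph {n : ℕ} (G : WeightedGraph (Fin n)) (mark : Fin n → Bool) : List Letter :=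
  (List.finRange n).flatMap fun u =>
    encodePlayer (G.owner u) ::
      ((if mark u then [Letter.targetMark] else []) ++
        (List.finRange n).flatMap fun v => encodeEntry (G.edge u v))

/-- The word that describes a mean-payoff game. -/
def MPInstance.encode (I : MPInstance) : List Letter :=
  encodeGraph I.graph fun _ => false

/-- The word that describes a min-cost reachability game. -/
def MCRInstance.encode (J : MCRInstance) : List Letter :=
  encodeGraph J.graph fun u => decide (u = J.target)

/-! The encodings are injective. -/

theorem block_inj {p : Letter → Bool} {a b : Letter} {s t r r' : List Letter}
    (hs : ∀ x ∈ s, p x = false) (ht : ∀ x ∈ t, p x = false)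
    (hr : ∀ x ∈ r.head?, p x = true) (hr' : ∀ x ∈ r'.head?, p x = true)
    (h : (a :: s) ++ r = (b :: t) ++ r') : a = b ∧ s = t ∧ r = r' := by
  simp only [List.cons_append, List.cons.injEq] at h
  obtain ⟨hab, h⟩ := h
  refine ⟨hab, ?_⟩
  induction s generalizing t with
  | nil =>
    cases t with
    | nil => simpa using h
    | cons y t =>
      exfalso
      simp only [List.nil_append, List.cons_append] at h
      have h1 := hr y (by simp [h])
      have h2 := ht y (by simp)
      simp_all
  | cons x s ih =>
    cases t with
    | nil =>
      exfalso
      simp only [List.nil_append, List.cons_append] at h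
      have h1 := hr' x (by simp [← h])
      have h2 := hs x (by simp)
      simp_all
    | cons y t =>
      simp only [List.cons_append, List.cons.injEq] at h
      have := ih (t := t) (fun z hz => hs z (by simp [hz])) (fun z hz => ht z (by simp [hz])) h.2
      exact ⟨by rw [h.1, this.1], this.2⟩

theorem flatMap_inj {α : Type} {p : Letter → Bool} (a b : α → Letter) (s t : α → List Letter)
    (ha : ∀ i, p (a i) = true) (hb : ∀ i, p (b i) = true)
    (hs : ∀ i, ∀ x ∈ s i, p x = false) (ht : ∀ i, ∀ x ∈ t i, p x = false)
    (L : List α) (h : (L.flatMap fun i => a i :: s i) = L.flatMap fun i => b i :: t i) :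
    ∀ i ∈ L, a i = b i ∧ s i = t i := by
  have hd : ∀ (c : α → Letter) (q : α → List Letter), (∀ i, p (c i) = true) → ∀ L : List α,
      ∀ x ∈ (L.flatMap fun i => c i :: q i).head?, p x = true := by
    intro c q hc L x hx
    cases L with
    | nil => simp at hx
    | cons j L =>
      simp only [List.flatMap_cons, List.cons_append, List.head?_cons, Option.mem_def,
        Option.some.injEq] at hx
      rw [← hx]
      exact hc j
  induction L with
  | nil => simp
  | cons j L ih =>
    rw [List.flatMap_cons, List.flatMap_cons] at h
    obtain ⟨h1, h2, h3⟩ := block_inj (hs j) (ht j) (hd a s ha L) (hd b t hb L) h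
    intro i hi
    rcases List.mem_cons.1 hi with rfl | hi
    · exact ⟨h1, h2⟩
    · exact ih h3 i hi

theorem bits_injective : Function.Injective Nat.bits := by
  intro m
  induction m using Nat.binaryRecFromOne with
  | zero =>
    intro k h
    by_contra hk
    have := congrArg List.length h
    rw [Nat.size_eq_bits_len, Nat.size_eq_bits_len] at this
    simp only [Nat.size_zero] at this
    exact hk (Nat.size_eq_zero.1 this.symm).symm
  | one =>
    intro k h
    have h1 := Nat.bodd_eq_bits_head k
    have h2 := Nat.div2_bits_eq_tail k
    rw [← h] at h1 h2
    have h4 : k.div2 = 0 := by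
      apply Nat.size_eq_zero.1
      rw [← Nat.size_eq_bits_len, h2]
      simp
    have h5 := Nat.bodd_add_div2 k
    simp [h1, h4] at h5
    omega
  | bit b m hm ih =>
    intro k h
    rw [Nat.bits_append_bit _ _ (fun h0 => absurd h0 hm)] at h
    have h1 := Nat.bodd_eq_bits_head k
    have h2 := Nat.div2_bits_eq_tail k
    rw [← h] at h1 h2
    have h3 : m = k.div2 := ih h2.symm
    rw [← Nat.bit_bodd_div2 k, h1, ← h3]
    rfl

theorem encodeEntry_injective : Function.Injective encodeEntry := by
  have key : ∀ w : ℤ, encodeEntry (some w) ≠ encodeEntry none := by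
    intro w
    simp only [encodeEntry]
    split_ifs <;> simp
  intro x y h
  cases x with
  | none =>
    cases y with
    | none => rfl
    | some w => exact absurd h.symm (key w)
  | some v =>
    cases y with
    | none => exact absurd h (key v)
    | some w =>
      simp only [encodeEntry, List.cons.injEq] at h
      have h1 : v.natAbs = w.natAbs :=
        bits_injective (List.map_injective_iff.2 (fun a b hab => by simpa using hab) h.2)
      have h2 := h.1
      congr 1
      split_ifs at h2 <;> omega

/-- The symbols that open a row. -/
def Letter.opensRow : Letter → Bool
  | .maxVertex | .minVertex => true
  | _ => false

/-- The symbols that open an entry. -/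
def Letter.opensEntry : Letter → Bool
  | .noEdge | .plus | .minus => true
  | _ => false

theorem encodeEntry_eq_cons (x : Option ℤ) : ∃ c q, encodeEntry x = c :: q ∧
    c.opensEntry = true ∧ (∀ z ∈ q, z.opensEntry = false) ∧
    ∀ z ∈ c :: q, z.opensRow = false ∧ z ≠ .targetMark := by
  cases x with
  | none => exact ⟨_, _, rfl, rfl, by simp, by simp [Letter.opensRow]⟩
  | some w =>
    refine ⟨_, _, rfl, ?_, ?_, ?_⟩
    · split_ifs <;> rfl
    · intro z hz
      obtain ⟨b, -, rfl⟩ := List.mem_map.1 hz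
      rfl
    · intro z hz
      rcases List.mem_cons.1 hz with rfl | hz
      · split_ifs <;> simp [Letter.opensRow]
      · obtain ⟨b, -, rfl⟩ := List.mem_map.1 hz
        simp [Letter.opensRow]

theorem encodeGraph_size {n : ℕ} (G : WeightedGraph (Fin n)) (mark : Fin n → Bool) :
    (encodeGraph G mark).countP Letter.opensRow = n := by
  have : ∀ u : Fin n, List.countP Letter.opensRow (encodePlayer (G.owner u) ::
      ((if mark u then [Letter.targetMark] else []) ++
        (List.finRange n).flatMap fun v => encodeEntry (G.edge u v))) = 1 := by
    intro u
    rw [List.countP_cons_of_pos (by cases G.owner u <;> rfl)]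
    simp only [Nat.add_eq_right, List.countP_eq_zero, List.mem_append, List.mem_flatMap]
    rintro z (hz | ⟨v, -, hz⟩)
    · split_ifs at hz
      · simp only [List.mem_singleton] at hz
        simp [hz, Letter.opensRow]
      · simp at hz
    · obtain ⟨c, q, h1, -, -, h2⟩ := encodeEntry_eq_cons (G.edge u v)
      rw [h1] at hz
      simp [(h2 z hz).1]
  rw [encodeGraph, List.countP_flatMap]
  simp [Function.comp_def, this]

theorem encodeGraph_inj {n : ℕ} {G H : WeightedGraph (Fin n)} {mark mark' : Fin n → Bool}
    (h : encodeGraph G mark = encodeGraph H mark') : G = H ∧ mark = mark' := by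
  have noRow : ∀ (G : WeightedGraph (Fin n)) (mark : Fin n → Bool) (u : Fin n),
      ∀ z ∈ ((if mark u then [Letter.targetMark] else []) ++
        (List.finRange n).flatMap fun v => encodeEntry (G.edge u v)), z.opensRow = false := by
    intro G mark u z hz
    rcases List.mem_append.1 hz with hz | hz
    · split_ifs at hz
      · simp only [List.mem_singleton] at hz
        simp [hz, Letter.opensRow]
      · simp at hz
    · obtain ⟨v, -, hz⟩ := List.mem_flatMap.1 hz
      obtain ⟨c, q, h1, -, -, h2⟩ := encodeEntry_eq_cons (G.edge u v)
      rw [h1] at hz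
      exact (h2 z hz).1
  have rows := flatMap_inj (p := Letter.opensRow) _ _ _ _
    (fun u => by cases G.owner u <;> rfl) (fun u => by cases H.owner u <;> rfl)
    (noRow G mark) (noRow H mark') _ h
  have noMark : ∀ (G : WeightedGraph (Fin n)) (u : Fin n), Letter.targetMark ∉
      (List.finRange n).flatMap fun v => encodeEntry (G.edge u v) := by
    intro G u hz
    obtain ⟨v, -, hz⟩ := List.mem_flatMap.1 hz
    obtain ⟨c, q, h1, -, -, h2⟩ := encodeEntry_eq_cons (G.edge u v)
    rw [h1] at hz
    exact (h2 _ hz).2 rfl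
  have hmark : mark = mark' := by
    funext u
    have h1 := congrArg (Letter.targetMark ∈ ·) (rows u (List.mem_finRange u)).2
    simp only [List.mem_append, noMark, or_false] at h1
    cases h2 : mark u <;> cases h3 : mark' u <;> simp [h2, h3] at h1 ⊢
  refine ⟨?_, hmark⟩
  have howner : G.owner = H.owner := by
    funext u
    have h1 := (rows u (List.mem_finRange u)).1
    cases h2 : G.owner u <;> cases h3 : H.owner u <;> simp [h2, h3, encodePlayer] at h1 ⊢
  have hedge : G.edge = H.edge := by
    funext u v
    have h1 := (rows u (List.mem_finRange u)).2
    rw [hmark, List.append_cancel_left_eq] at h1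
    choose c q hcq h2 h3 _ using encodeEntry_eq_cons
    simp only [hcq] at h1
    have h4 := flatMap_inj (p := Letter.opensEntry) _ _ _ _ (fun v => h2 _) (fun v => h2 _)
      (fun v => h3 _) (fun v => h3 _) _ h1 v (List.mem_finRange v)
    exact encodeEntry_injective (by rw [hcq, hcq, h4.1, h4.2])
  cases G
  cases H
  simp_all

theorem MPInstance.encode_injective : Function.Injective MPInstance.encode := by
  rintro ⟨n, G⟩ ⟨m, H⟩ h
  have hn : n = m := by
    rw [← encodeGraph_size G fun _ => false, ← encodeGraph_size H fun _ => false]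
    exact congrArg _ h
  subst hn
  obtain rfl : G = H := (encodeGraph_inj h).1
  rfl

theorem MCRInstance.encode_injective : Function.Injective MCRInstance.encode := by
  rintro ⟨n, G, t⟩ ⟨m, H, t'⟩ h
  have hn : n = m := by
    rw [← encodeGraph_size G fun u => decide (u = t),
      ← encodeGraph_size H fun u => decide (u = t')]
    exact congrArg _ h
  subst hn
  obtain ⟨h1, h2⟩ := encodeGraph_inj h
  have h3 := congrFun h2 t
  simp only [decide_true, true_eq_decide_iff] at h3
  obtain rfl : G = H := h1
  obtain rfl : t = t' := h3
  rfl

/-- `f` is computed in polynomial time by a Turing machine that works on the words describing the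
games. -/
def PolyTimeComputable (f : MPInstance → MCRInstance) : Prop :=
  Nonempty (Turing.TM2ComputableInPolyTime MPInstance.encode MCRInstance.encode f)

end MCRGames

/-!
Positions of a play are viewed as states, pairs of a vertex and the weight accumulated so far. Both
games are then reduced to reachability on states: `Attr ω Z k` is the set of states from which Min
can force a visit of `Z` within `k` moves. Outside of all attractors of `Z`, Max can stay outside
(`forces_max_not_attr`), and a player who can maintain an invariant of time, vertex and accumulated
weight has a strategy that does so (`exists_max_strategy`, `exists_min_strategy`).

In a min-cost reachability game, either Min can force a visit of the target with weight at most `N`,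
so that the upper value is at most `N`, or Max can prevent it, so that the lower value is at least
`N + 1`. Hence the value exists, and it is `-∞` if and only if Min can do so for all `N`
(`IsSink.exists_hasValue`).

In a mean-payoff game, let `W` be the set of vertices from which Min can force arbitrarily small
accumulated weights. Outside of `W`, Max keeps the accumulated weight bounded from below, so the
lower value is at least `0`. From a vertex of `W`, Min can force a negative accumulated weight
without leaving `W` (`ForcesUnbounded.exists_attr`), hence, repeating this, a decrease at a linear
rate (`ForcesUnbounded.exists_strategy`), so the upper value is negative. Applied to the weights
`q * w - p`, this dichotomy compares the lower and the upper value with `p / q`, for every rational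
number `p / q`. So they agree, and the value is negative exactly on `W`
(`exists_hasValue_meanPayoff`).

If no vertex has value `+∞` in the reachability game, then Min can force a visit of the target from
everywhere, at a bounded cost. Forcing a small accumulated weight and then a visit of the target,
Min obtains value `-∞` on `W`; the converse is clear (`reachesAtMost_iff_forcesUnbounded`).

Conversely, a mean-payoff game becomes a reachability game without value `+∞` if Min is allowed to
stop before every move, at no cost, by moving to a new target (`stopping`). Min forces arbitrarily
small payoffs there exactly if Min forces arbitrarily small accumulated weights in the given game
(`stopping_reachesAtMost_iff`). With the stopping vertices numbered first and the target last, the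
matrix of the new game consists of rows with two edges each, of the rows of the old matrix padded
with missing edges, and of the row of the target (`MPInstance.encode_toMCR`). A stack machine with
the number of vertices in unary on its counters writes this word in quadratic time
(`polyTimeComputable_toMCR`).
-/

namespace MCRGames

namespace WeightedGraph

/-! ### Controllable predecessors and attractors -/

variable {V : Type*} (G : WeightedGraph V)

/-- States are pairs of a vertex and an accumulated weight; the move `(v, u)` adds `ω v u`.
Player `p` can force that the successor of the state `(v, s)` satisfies `P`. -/
def Forces (p : Player) (ω : V → V → ℤ) (P : V → ℤ → Prop) (v : V) (s : ℤ) : Prop :=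
  (G.owner v = p → ∃ u, G.IsEdge v u ∧ P u (s + ω v u)) ∧
    (G.owner v ≠ p → ∀ u, G.IsEdge v u → P u (s + ω v u))

/-- Min can force a visit of the set of states `Z` within `k` moves. -/
def Attr (ω : V → V → ℤ) (Z : V → ℤ → Prop) : ℕ → V → ℤ → Prop
  | 0 => Z
  | k + 1 => fun v s => Z v s ∨ G.Forces .min ω (Attr ω Z k) v s

variable {G} {ω : V → V → ℤ} {Z Z' P Q : V → ℤ → Prop}

theorem Forces.of_step {p : Player} {v : V} {s s' : ℤ} (h : G.Forces p ω P v s)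
    (hPQ : ∀ u, G.IsEdge v u → P u (s + ω v u) → Q u (s' + ω v u)) : G.Forces p ω Q v s' := by
  refine ⟨fun hp => ?_, fun hp u hu => hPQ u hu (h.2 hp u hu)⟩
  obtain ⟨u, hu, h⟩ := h.1 hp
  exact ⟨u, hu, hPQ u hu h⟩

theorem forces_max_of_not_forces_min {v : V} {s : ℤ} (h : ¬ G.Forces .min ω P v s) :
    G.Forces .max ω (fun u t => ¬ P u t) v s := by
  cases hv : G.owner v <;> simpa [Forces, hv] using h

theorem not_forces_min_of_forces_max {v : V} {s : ℤ}
    (h : G.Forces .max ω (fun u t => ¬ P u t) v s) : ¬ G.Forces .min ω P v s := by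
  cases hv : G.owner v <;> simpa [Forces, hv] using h

theorem Attr.of_mem {v : V} {s : ℤ} (h : Z v s) : ∀ k, G.Attr ω Z k v s
  | 0 => h
  | _ + 1 => Or.inl h

theorem Attr.succ {k : ℕ} : ∀ {v : V} {s : ℤ}, G.Attr ω Z k v s → G.Attr ω Z (k + 1) v s := by
  induction k with
  | zero => exact fun h => Or.inl h
  | succ k ih => exact fun h => h.imp_right fun h => h.of_step fun u _ hu => ih hu

theorem Attr.le {k l : ℕ} (hkl : k ≤ l) {v : V} {s : ℤ} (h : G.Attr ω Z k v s) :
    G.Attr ω Z l v s := by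
  induction hkl with
  | refl => exact h
  | step _ ih => exact ih.succ

theorem Attr.mono (hZ : ∀ u t, Z u t → Z' u t) {k : ℕ} :
    ∀ {v : V} {s : ℤ}, G.Attr ω Z k v s → G.Attr ω Z' k v s := by
  induction k with
  | zero => exact hZ _ _
  | succ k ih => exact fun h => h.imp (hZ _ _) fun h => h.of_step fun u _ hu => ih hu

/-- Attractors are invariant under a translation of the accumulated weight. -/
theorem Attr.shift (c : ℤ) (hZ : ∀ u t, Z u t → Z' u (t + c)) {k : ℕ} :
    ∀ {v : V} {s : ℤ}, G.Attr ω Z k v s → G.Attr ω Z' k v (s + c) := by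
  induction k with
  | zero => exact hZ _ _
  | succ k ih =>
    exact fun h => h.imp (hZ _ _) fun h => h.of_step fun u _ hu => by
      rw [add_right_comm]; exact ih hu

/-- If Min can continue from `Z` to `Z'`, then the attractors of `Z` lie in those of `Z'`. -/
theorem Attr.trans {l : ℕ} (hZ : ∀ u t, Z u t → G.Attr ω Z' l u t) {k : ℕ} :
    ∀ {v : V} {s : ℤ}, G.Attr ω Z k v s → G.Attr ω Z' (k + l) v s := by
  induction k with
  | zero => intro v s h; rw [zero_add]; exact hZ _ _ h
  | succ k ih =>
    intro v s h
    rcases h with h | h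
    · exact (hZ _ _ h).le (by omega)
    · rw [Nat.succ_add]
      exact Or.inr (h.of_step fun u _ hu => ih hu)

/-- A set of states that Max can keep and that is disjoint from `Z` is disjoint from the attractors
of `Z`. -/
theorem not_attr_of_invariant (hstep : ∀ u t, P u t → G.Forces .max ω P u t)
    (hdis : ∀ u t, P u t → ¬ Z u t) (k : ℕ) : ∀ {v : V} {s : ℤ}, P v s → ¬ G.Attr ω Z k v s := by
  induction k with
  | zero => exact hdis _ _
  | succ k ih =>
    rintro v s h (h' | h')
    · exact hdis _ _ h h'
    · exact not_forces_min_of_forces_max ((hstep _ _ h).of_step fun u _ hu => ih hu) h'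

/-- Finitely many vertices share a bound on the number of moves. -/
theorem exists_uniform [Finite V] {p : V → Prop} {q : ℕ → V → Prop}
    (hq : ∀ u k l, k ≤ l → q k u → q l u) (h : ∀ u, p u → ∃ k, q k u) :
    ∃ K, ∀ u, p u → q K u := by
  have h' : ∀ u, ∃ k, p u → q k u := fun u => by
    by_cases hu : p u
    · exact (h u hu).imp fun _ h _ => h
    · exact ⟨0, fun h => absurd h hu⟩
  choose f hf using h'
  obtain ⟨K, hK⟩ := (Set.finite_range f).bddAbove
  exact ⟨K, fun u hu => hq u _ _ (hK ⟨u, rfl⟩) (hf u hu)⟩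

/-- Max can keep the states from which Min cannot force a visit of `Z`. -/
theorem forces_max_not_attr [Finite V] {v : V} {s : ℤ} (h : ∀ k, ¬ G.Attr ω Z k v s) :
    G.Forces .max ω (fun u t => ∀ k, ¬ G.Attr ω Z k u t) v s := by
  by_contra hc
  have hmin : G.Forces .min ω (fun u t => ∃ k, G.Attr ω Z k u t) v s := by
    by_contra hm
    exact hc ((forces_max_of_not_forces_min hm).of_step fun u _ hu => by simpa using hu)
  obtain ⟨K, hK⟩ := exists_uniform (p := fun u => ∃ k, G.Attr ω Z k u (s + ω v u))
    (q := fun k u => G.Attr ω Z k u (s + ω v u)) (fun _ _ _ hkl h => h.le hkl) fun _ hu => hu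
  exact h (K + 1) (Or.inr (hmin.of_step fun u _ hu => hK u hu))

/-! ### Strategies that maintain an invariant -/

/-- The sum of `ω` over the consecutive pairs of a list. -/
def listSum (ω : V → V → ℤ) : List V → ℤ
  | a :: b :: l => ω a b + listSum ω (b :: l)
  | _ => 0

theorem listSum_append (ω : V → V → ℤ) (h : List V) (v u : V) :
    listSum ω (h ++ [v, u]) = listSum ω (h ++ [v]) + ω v u := by
  induction h with
  | nil => simp [listSum]
  | cons a h ih =>
    cases h with
    | nil => simp [listSum]
    | cons b h => simp only [List.cons_append, listSum] at ih ⊢; rw [ih, add_assoc]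

/-- The accumulated weight of the first `k` moves of a play. -/
def accSum (ω : V → V → ℤ) (π : ℕ → V) (k : ℕ) : ℤ :=
  ∑ i ∈ Finset.range k, ω (π i) (π (i + 1))

theorem accSum_succ (ω : V → V → ℤ) (π : ℕ → V) (k : ℕ) :
    accSum ω π (k + 1) = accSum ω π k + ω (π k) (π (k + 1)) :=
  Finset.sum_range_succ _ _

variable (G) in
open Classical in
/-- The strategy of player `p` that moves to a successor satisfying `P k` with the new accumulated
weight, where `k` is the new time, whenever there is one. -/
noncomputable def maintain (p : Player) (ω : V → V → ℤ) (P : ℕ → V → ℤ → Prop) :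
    G.Strategy p where
  next h v :=
    if hu : ∃ u, G.IsEdge v u ∧ P (h.length + 1) u (listSum ω (h ++ [v]) + ω v u) then hu.choose
    else (G.deadlockFree v).choose
  legal h v _ := by
    split_ifs with hu
    · exact hu.choose_spec.1
    · exact (G.deadlockFree v).choose_spec

theorem maintain_spec {p : Player} {ω : V → V → ℤ} {P : ℕ → V → ℤ → Prop} {h : List V} {v : V}
    {k : ℕ} {s : ℤ} (hk : h.length = k) (hs : listSum ω (h ++ [v]) = s) (hp : G.owner v = p)
    (hP : G.Forces p ω (P (k + 1)) v s) :
    P (k + 1) ((G.maintain p ω P).next h v) (s + ω v ((G.maintain p ω P).next h v)) := by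
  subst hk hs
  have hu := hP.1 hp
  simp only [maintain, dif_pos hu]
  exact hu.choose_spec.2

variable {σ : G.Strategy .max} {τ : G.Strategy .min}

theorem position_length (v : V) (k : ℕ) : (position σ τ v k).1.length = k := by
  induction k with
  | zero => rfl
  | succ k ih => simp [position, ih]

theorem listSum_position (ω : V → V → ℤ) (v : V) (k : ℕ) :
    listSum ω ((position σ τ v k).1 ++ [outcome σ τ v k]) = accSum ω (outcome σ τ v) k := by
  induction k with
  | zero => simp [position, accSum, listSum]
  | succ k ih =>
    rw [accSum_succ, ← ih, ← listSum_append]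
    simp [position, outcome]

theorem outcome_succ_of_max {v : V} {k : ℕ} (h : G.owner (outcome σ τ v k) = .max) :
    outcome σ τ v (k + 1) = σ.next (position σ τ v k).1 (outcome σ τ v k) := by
  simp only [outcome] at h
  simp only [outcome, position, h]

theorem outcome_succ_of_min {v : V} {k : ℕ} (h : G.owner (outcome σ τ v k) = .min) :
    outcome σ τ v (k + 1) = τ.next (position σ τ v k).1 (outcome σ τ v k) := by
  simp only [outcome] at h
  simp only [outcome, position, h]

theorem isEdge_outcome (v : V) (k : ℕ) :
    G.IsEdge (outcome σ τ v k) (outcome σ τ v (k + 1)) := by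
  cases h : G.owner (outcome σ τ v k) with
  | max => rw [outcome_succ_of_max h]; exact σ.legal _ _ h
  | min => rw [outcome_succ_of_min h]; exact τ.legal _ _ h

/-- If Max can keep the invariant `P` of time, vertex and accumulated weight in every move, then Max
has a strategy that keeps it. -/
theorem exists_max_strategy {ω : V → V → ℤ} {P : ℕ → V → ℤ → Prop}
    (hstep : ∀ k u s, P k u s → G.Forces .max ω (P (k + 1)) u s) {v : V} (h0 : P 0 v 0) :
    ∃ σ : G.Strategy .max, ∀ (τ : G.Strategy .min) k,
      P k (outcome σ τ v k) (accSum ω (outcome σ τ v) k) := by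
  refine ⟨G.maintain .max ω P, fun τ k => ?_⟩
  induction k with
  | zero => exact h0
  | succ k ih =>
    have h := hstep _ _ _ ih
    rw [accSum_succ]
    by_cases hp : G.owner (outcome (G.maintain .max ω P) τ v k) = .max
    · rw [outcome_succ_of_max hp]
      exact maintain_spec (position_length _ _) (listSum_position _ _ _) hp h
    · exact h.2 hp _ (isEdge_outcome _ _)

/-- If Min can keep the invariant `P` of time, vertex and accumulated weight in every move, then Min
has a strategy that keeps it. -/
theorem exists_min_strategy {ω : V → V → ℤ} {P : ℕ → V → ℤ → Prop}
    (hstep : ∀ k u s, P k u s → G.Forces .min ω (P (k + 1)) u s) {v : V} (h0 : P 0 v 0) :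
    ∃ τ : G.Strategy .min, ∀ (σ : G.Strategy .max) k,
      P k (outcome σ τ v k) (accSum ω (outcome σ τ v) k) := by
  refine ⟨G.maintain .min ω P, fun σ k => ?_⟩
  induction k with
  | zero => exact h0
  | succ k ih =>
    have h := hstep _ _ _ ih
    rw [accSum_succ]
    by_cases hp : G.owner (outcome σ (G.maintain .min ω P) v k) = .min
    · rw [outcome_succ_of_min hp]
      exact maintain_spec (position_length _ _) (listSum_position _ _ _) hp h
    · exact h.2 hp _ (isEdge_outcome _ _)

variable (G) in
theorem lowerValue_le_upperValue (payoff : (ℕ → V) → EReal) (v : V) :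
    G.lowerValue payoff v ≤ G.upperValue payoff v :=
  iSup_iInf_le_iInf_iSup _

end WeightedGraph

namespace WeightedGraph

variable {V : Type*} {G : WeightedGraph V} {ω : V → V → ℤ} {T : Set V}
  {σ : G.Strategy .max} {τ : G.Strategy .min}

/-! ### Values of min-cost reachability games -/

theorem IsSink.eq_of_isEdge (hT : G.IsSink T) {v u : V} (hv : v ∈ T) (hu : G.IsEdge v u) :
    u = v := by
  by_contra h
  simp [IsEdge, (hT v hv).2 u h] at hu

theorem IsSink.weight_self (hT : G.IsSink T) {v : V} (hv : v ∈ T) : G.weight v v = 0 := by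
  simp [weight, (hT v hv).1]

theorem IsSink.isEdge_self (hT : G.IsSink T) {v : V} (hv : v ∈ T) : G.IsEdge v v := by
  simp [IsEdge, (hT v hv).1]

/-- In a vertex of `T`, the only move changes neither the vertex nor the accumulated weight. -/
theorem IsSink.forces (hT : G.IsSink T) {p : Player} {P : V → ℤ → Prop} {v : V} {s : ℤ}
    (hv : v ∈ T) (h : P v s) : G.Forces p G.weight P v s := by
  have h0 : P v (s + G.weight v v) := by rwa [hT.weight_self hv, add_zero]
  exact ⟨fun _ => ⟨v, hT.isEdge_self hv, h0⟩, fun _ u hu => by rwa [hT.eq_of_isEdge hv hu]⟩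

theorem IsSink.outcome_eq (hT : G.IsSink T) {v : V} {k : ℕ} (hk : outcome σ τ v k ∈ T) (j : ℕ) :
    outcome σ τ v (k + j) = outcome σ τ v k ∧
      accSum G.weight (outcome σ τ v) (k + j) = accSum G.weight (outcome σ τ v) k := by
  induction j with
  | zero => exact ⟨rfl, rfl⟩
  | succ j ih =>
    have h := hT.eq_of_isEdge (ih.1.symm ▸ hk) (isEdge_outcome (σ := σ) (τ := τ) v (k + j))
    rw [← add_assoc, accSum_succ, h, ih.1, ih.2, hT.weight_self hk]
    simp

theorem IsSink.mcrPayoff_outcome (hT : G.IsSink T) {v : V} {k : ℕ} (hk : outcome σ τ v k ∈ T) :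
    G.mcrPayoff T (outcome σ τ v) = ((accSum G.weight (outcome σ τ v) k : ℝ) : EReal) := by
  classical
  have hex : ∃ k, outcome σ τ v k ∈ T := ⟨k, hk⟩
  rw [mcrPayoff, dif_pos hex]
  obtain ⟨j, hj⟩ := Nat.exists_eq_add_of_le (Nat.find_min' hex hk)
  have h := (hT.outcome_eq (Nat.find_spec hex) j).2
  rw [← hj] at h
  rw [h]
  rfl

theorem le_mcrPayoff {π : ℕ → V} {N : ℤ} (h : ∀ k, ¬ (π k ∈ T ∧ accSum G.weight π k ≤ N)) :
    (((N + 1 : ℤ) : ℝ) : EReal) ≤ G.mcrPayoff T π := by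
  classical
  rw [mcrPayoff]
  split_ifs with hex
  · have h1 := h (Nat.find hex)
    have h2 : N + 1 ≤ G.prefixPayoff π (Nat.find hex) := by
      by_contra hc
      exact h1 ⟨Nat.find_spec hex, show G.prefixPayoff π _ ≤ N by omega⟩
    exact_mod_cast h2
  · exact le_top

/-- Min can force a visit of `T` with total weight at most `N`. -/
def ReachesAtMost (G : WeightedGraph V) (T : Set V) (N : ℤ) (v : V) : Prop :=
  ∃ k, G.Attr G.weight (fun u t => u ∈ T ∧ t ≤ N) k v 0

theorem ReachesAtMost.mono {N N' : ℤ} (hN : N ≤ N') {v : V} (h : G.ReachesAtMost T N v) :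
    G.ReachesAtMost T N' v :=
  h.imp fun _ h => h.mono fun _ _ h => ⟨h.1, h.2.trans hN⟩

/-- Min follows the attractors for `K` moves. Since `T` consists of sinks, the payoff is the
accumulated weight at time `K`, even if `T` is reached before. -/
theorem IsSink.upperValue_le (hT : G.IsSink T) {N : ℤ} {v : V} (h : G.ReachesAtMost T N v) :
    G.upperValue (G.mcrPayoff T) v ≤ ((N : ℝ) : EReal) := by
  obtain ⟨K, hK⟩ := h
  set Z : V → ℤ → Prop := fun u t => u ∈ T ∧ t ≤ N
  have hZ : ∀ (P : V → ℤ → Prop), (∀ u t, Z u t → P u t) → ∀ u t, Z u t →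
      G.Forces .min G.weight P u t := fun P hP u t h => hT.forces h.1 (hP u t h)
  obtain ⟨τ, hτ⟩ := exists_min_strategy (P := fun k => G.Attr G.weight Z (K - k)) (v := v)
    (fun k u s h => by
      rcases hk : K - k with _ | j
      · rw [hk] at h
        exact hZ _ (fun _ _ h => .of_mem h _) _ _ h
      · rw [hk] at h
        rw [show K - (k + 1) = j by omega]
        rcases h with h | h
        · exact hZ _ (fun _ _ h => .of_mem h _) _ _ h
        · exact h) hK
  refine iInf_le_of_le τ (iSup_le fun σ => ?_)
  have h := hτ σ K
  rw [Nat.sub_self] at h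
  rw [hT.mcrPayoff_outcome h.1]
  exact_mod_cast h.2

theorem le_lowerValue_mcrPayoff [Finite V] {N : ℤ} {v : V} (h : ¬ G.ReachesAtMost T N v) :
    (((N + 1 : ℤ) : ℝ) : EReal) ≤ G.lowerValue (G.mcrPayoff T) v := by
  obtain ⟨σ, hσ⟩ := exists_max_strategy (ω := G.weight) (v := v)
    (P := fun _ u t => ∀ k, ¬ G.Attr G.weight (fun u t => u ∈ T ∧ t ≤ N) k u t)
    (fun k u s h => forces_max_not_attr h) (not_exists.1 h)
  exact le_iSup_of_le σ (le_iInf fun τ => le_mcrPayoff fun k => hσ τ k 0)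

theorem eReal_eq_bot_of_forall_le {x : EReal} (h : ∀ N : ℤ, x ≤ ((N : ℝ) : EReal)) : x = ⊥ := by
  rw [EReal.eq_bot_iff_forall_lt]
  intro y
  obtain ⟨N, hN⟩ := exists_int_lt y
  exact (h N).trans_lt (by exact_mod_cast hN)

theorem eReal_eq_top_of_forall_le {x : EReal} (h : ∀ N : ℤ, ((N : ℝ) : EReal) ≤ x) : x = ⊤ := by
  rw [EReal.eq_top_iff_forall_lt]
  intro y
  obtain ⟨N, hN⟩ := exists_int_gt y
  exact lt_of_lt_of_le (by exact_mod_cast hN) (h N)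

theorem hasValue_of_le {payoff : (ℕ → V) → EReal} {v : V} {x : EReal}
    (h1 : x ≤ G.lowerValue payoff v) (h2 : G.upperValue payoff v ≤ x) : G.HasValue payoff v x :=
  ⟨((G.lowerValue_le_upperValue payoff v).trans h2).antisymm h1,
    h2.antisymm (h1.trans (G.lowerValue_le_upperValue payoff v))⟩

theorem hasValue_top [Finite V] {v : V} (h : ∀ N, ¬ G.ReachesAtMost T N v) :
    G.HasValue (G.mcrPayoff T) v ⊤ := by
  refine hasValue_of_le (le_of_eq (eReal_eq_top_of_forall_le fun N => ?_).symm) le_top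
  simpa using le_lowerValue_mcrPayoff (h (N - 1))

/-- Min-cost reachability games are determined, and the value is `-∞` exactly if Min can force a
visit of the target with arbitrarily small total weight: otherwise the value is the least `N` such
that Min can force a visit with total weight at most `N`, or `+∞` if there is none. -/
theorem IsSink.exists_hasValue [Finite V] (hT : G.IsSink T) (v : V) :
    ∃ x, G.HasValue (G.mcrPayoff T) v x ∧ (x = ⊥ ↔ ∀ N, G.ReachesAtMost T N v) := by
  by_cases h1 : ∀ N, G.ReachesAtMost T N v
  · refine ⟨⊥, hasValue_of_le bot_le ?_, by simpa using h1⟩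
    exact (eReal_eq_bot_of_forall_le fun N => hT.upperValue_le (h1 N)).le
  · by_cases h2 : ∃ N, G.ReachesAtMost T N v
    · obtain ⟨N₀, hN₀⟩ := not_forall.1 h1
      obtain ⟨N, hN, hmin⟩ := Int.exists_least_of_bdd (P := fun N => G.ReachesAtMost T N v)
        ⟨N₀, fun N hN => le_of_not_ge fun h => hN₀ (hN.mono h)⟩ h2
      refine ⟨((N : ℝ) : EReal), hasValue_of_le ?_ (hT.upperValue_le hN), by simpa using h1⟩
      have := le_lowerValue_mcrPayoff (T := T) (v := v) (N := N - 1) fun h => by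
        have := hmin _ h
        omega
      simpa using this
    · exact ⟨⊤, hasValue_top (not_exists.1 h2), by simpa using h1⟩

theorem not_hasValue_top (hT : G.IsSink T) {N : ℤ} {v : V} (h : G.ReachesAtMost T N v) :
    ¬ G.HasValue (G.mcrPayoff T) v ⊤ := by
  intro hv
  have := hT.upperValue_le h
  rw [hv.2] at this
  simp at this

/-! ### Mean-payoff games -/

/-- Min can force arbitrarily small accumulated weights. -/
def ForcesUnbounded (G : WeightedGraph V) (ω : V → V → ℤ) (v : V) : Prop :=
  ∀ C : ℤ, ∃ k, G.Attr ω (fun _ t => t ≤ C) k v 0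

theorem exists_abs_le [Finite V] (f : V → V → ℤ) : ∃ B, ∀ u v, |f u v| ≤ B := by
  obtain ⟨B, hB⟩ := (Set.finite_range fun p : V × V => |f p.1 p.2|).bddAbove
  exact ⟨B, fun u v => hB ⟨(u, v), rfl⟩⟩

/-- Outside of the vertices from which Min can force arbitrarily small accumulated weights,
there is a common lower bound that Max can guarantee. -/
theorem exists_bound_of_not_forcesUnbounded [Finite V] (G : WeightedGraph V) (ω : V → V → ℤ) :
    ∃ M : ℤ, ∀ u, ¬ G.ForcesUnbounded ω u → ∀ k, ¬ G.Attr ω (fun _ t => t ≤ M) k u 0 := by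
  have h : ∀ u, ∃ M : ℤ, ¬ G.ForcesUnbounded ω u → ∀ k, ¬ G.Attr ω (fun _ t => t ≤ M) k u 0 := by
    intro u
    by_cases hu : G.ForcesUnbounded ω u
    · exact ⟨0, fun h => absurd hu h⟩
    · simp only [ForcesUnbounded, not_forall, not_exists] at hu
      exact hu.imp fun _ h _ => h
  choose M hM using h
  obtain ⟨B, hB⟩ := (Set.finite_range M).bddBelow
  exact ⟨B, fun u hu k hk => hM u hu k (hk.mono fun _ t ht => ht.trans (hB ⟨u, rfl⟩))⟩

/-- From a vertex where Min can force arbitrarily small accumulated weights, Min can force a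
negative accumulated weight without leaving the set of these vertices. Otherwise Max could keep the
accumulated weight nonnegative until the play leaves this set, and bounded from below afterwards. -/
theorem ForcesUnbounded.exists_attr [Finite V] {v : V} (hv : G.ForcesUnbounded ω v) :
    ∃ k, G.Attr ω (fun u t => G.ForcesUnbounded ω u ∧ t ≤ -1) k v 0 := by
  by_contra hc
  rw [not_exists] at hc
  obtain ⟨M, hM⟩ := exists_bound_of_not_forcesUnbounded G ω
  obtain ⟨B, hB⟩ := exists_abs_le ω
  set Z : V → ℤ → Prop := fun u t => G.ForcesUnbounded ω u ∧ t ≤ -1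
  -- when the play leaves the set, the accumulated weight is at least `-B`
  set C : ℤ := -|M| - B - 1
  obtain ⟨k, hk⟩ := hv C
  refine not_attr_of_invariant (P := fun u t =>
    (G.ForcesUnbounded ω u ∧ ∀ k, ¬ G.Attr ω Z k u t) ∨
    (C < t ∧ ∀ k, ¬ G.Attr ω (fun _ t => t ≤ C) k u t)) ?_ ?_ k (Or.inl ⟨hv, hc⟩) hk
  · rintro u t (⟨hu, h⟩ | ⟨-, h⟩)
    · refine (forces_max_not_attr h).of_step fun u' _ hu' => ?_
      by_cases hW : G.ForcesUnbounded ω u'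
      · exact Or.inl ⟨hW, hu'⟩
      · have ht : 0 ≤ t := by
          by_contra ht
          exact h 0 ⟨hu, by omega⟩
        have hω := abs_le.1 (hB u u')
        have hM' := neg_abs_le M
        have hM0 := abs_nonneg M
        refine Or.inr ⟨by omega, fun k hk => hM u' hW k ?_⟩
        have := hk.shift (Z' := fun _ s => s ≤ M) (-(t + ω u u')) fun _ s hs => by omega
        simpa using this
    · refine (forces_max_not_attr h).of_step fun u' _ hu' => Or.inr ⟨?_, hu'⟩
      by_contra hc
      exact hu' 0 (not_lt.1 hc)
  · rintro u t (⟨hu, h⟩ | ⟨h, -⟩)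
    · have : 0 ≤ t := by
        by_contra ht
        exact h 0 ⟨hu, by omega⟩
      have hM0 := abs_nonneg M
      have hB0 := (abs_nonneg _).trans (hB u u)
      omega
    · exact not_le.2 h

/-- From a vertex where Min can force arbitrarily small accumulated weights, Min can make the
accumulated weight decrease at a linear rate: Min forces one decrease after the other, each within
`K` moves. -/
theorem ForcesUnbounded.exists_strategy [Finite V] {v : V} (hv : G.ForcesUnbounded ω v) :
    ∃ (K : ℕ) (C : ℤ) (τ : G.Strategy .min), 0 < K ∧ ∀ (σ : G.Strategy .max) (k : ℕ),
      K * accSum ω (outcome σ τ v) k ≤ C - k := by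
  obtain ⟨K₀, hK₀⟩ := exists_uniform (p := G.ForcesUnbounded ω)
    (q := fun k u => G.Attr ω (fun u t => G.ForcesUnbounded ω u ∧ t ≤ -1) k u 0)
    (fun _ _ _ hkl h => h.le hkl) fun _ hu => hu.exists_attr
  obtain ⟨K, hK, hKpos⟩ : ∃ K, K₀ ≤ K ∧ 0 < K := ⟨K₀ + 1, by omega, by omega⟩
  obtain ⟨B, hB⟩ := exists_abs_le ω
  have hB0 : 0 ≤ B := (abs_nonneg _).trans (hB v v)
  -- `Z c` is the aim of a round
  set Z : ℤ → V → ℤ → Prop := fun c u t => G.ForcesUnbounded ω u ∧ t ≤ c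
  have hround : ∀ u s, G.ForcesUnbounded ω u → G.Attr ω (Z (s - 1)) K u s := by
    intro u s hu
    have := ((hK₀ u hu).le hK).shift (Z' := Z (s - 1)) s fun u t h => ⟨h.1, by have := h.2; omega⟩
    rwa [zero_add] at this
  -- the invariant speaks of a round with aim `Z c` of which at most `j` moves remain: every move
  -- decreases `j + K * c`, since the next round has a smaller `c` and at most `K` moves
  obtain ⟨τ, hτ⟩ := exists_min_strategy (G := G) (ω := ω) (v := v) (P := fun k u s =>
      ∃ (c : ℤ) (j : ℕ), j ≤ K ∧ G.Attr ω (Z c) j u s ∧ s ≤ c + 1 + B * (K - j) ∧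
        (j + K * c : ℤ) ≤ -k)
    (fun k u s ⟨c, j, hj, h, hs, hc⟩ => by
      -- it suffices to consider rounds that are not completed
      obtain ⟨c, j, hj, hstep, hs, hc⟩ : ∃ (c : ℤ) (j : ℕ), j + 1 ≤ K ∧
          G.Forces .min ω (G.Attr ω (Z c) j) u s ∧ s ≤ c + 1 + B * (K - (j + 1)) ∧
          (j + 1 + K * c : ℤ) ≤ -k := by
        by_cases hZ : Z c u s
        · obtain ⟨i, rfl⟩ := Nat.exists_eq_succ_of_ne_zero hKpos.ne'
          refine ⟨s - 1, i, le_rfl, ?_, ?_, ?_⟩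
          · rcases hround u s hZ.1 with h | h
            · have := h.2
              omega
            · exact h
          · push_cast; nlinarith
          · have := hZ.2
            have hi : (0 : ℤ) ≤ (i + 1 : ℕ) := by positivity
            push_cast at hc hi ⊢
            nlinarith
        · rcases j with _ | j
          · exact absurd h hZ
          · exact ⟨c, j, hj, h.resolve_left hZ, by push_cast at hs; linarith, by
              push_cast at hc; linarith⟩
      refine hstep.of_step fun u' _ h' => ⟨c, j, by omega, h', ?_, ?_⟩
      · have := (abs_le.1 (hB u u')).2
        nlinarith
      · push_cast
        linarith)
    ⟨-1, K, le_rfl, by simpa using hround v 0 hv, by simp, by simp⟩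
  refine ⟨K, K * (1 + B * K), τ, hKpos, fun σ k => ?_⟩
  obtain ⟨c, j, hj, -, hs, hc⟩ := hτ σ k
  have hK0 : (0 : ℤ) < K := by exact_mod_cast hKpos
  have hj0 : (0 : ℤ) ≤ j := by positivity
  have h1 : accSum ω (outcome σ τ v) k ≤ c + 1 + B * K := by nlinarith
  nlinarith

theorem exists_max_strategy_of_not_forcesUnbounded [Finite V] {v : V}
    (hv : ¬ G.ForcesUnbounded ω v) :
    ∃ (C : ℤ) (σ : G.Strategy .max), ∀ (τ : G.Strategy .min) (k : ℕ),
      C < accSum ω (outcome σ τ v) k := by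
  simp only [ForcesUnbounded, not_forall, not_exists] at hv
  obtain ⟨C, hC⟩ := hv
  obtain ⟨σ, hσ⟩ := exists_max_strategy (ω := ω) (v := v)
    (P := fun _ u t => ∀ k, ¬ G.Attr ω (fun _ t => t ≤ C) k u t)
    (fun k u s h => forces_max_not_attr h) hC
  exact ⟨C, σ, fun τ k => not_le.1 (hσ τ k 0)⟩

theorem tendsto_add_div (r C : ℝ) :
    Tendsto (fun k : ℕ => ((r + C / k : ℝ) : EReal)) atTop (nhds (r : EReal)) := by
  refine (continuous_coe_real_ereal.tendsto _).comp ?_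
  simpa using (tendsto_const_div_atTop_nhds_zero_nat C).const_add r

theorem le_meanPayoff {π : ℕ → V} {r C : ℝ}
    (h : ∀ k : ℕ, r * k + C ≤ G.prefixPayoff π k) : (r : EReal) ≤ G.meanPayoff π := by
  rw [← (tendsto_add_div r C).liminf_eq]
  refine liminf_le_liminf ?_
  filter_upwards [eventually_gt_atTop 0] with k hk
  have hk' : (0 : ℝ) < k := by exact_mod_cast hk
  rw [EReal.coe_le_coe_iff, le_div_iff₀ hk', add_mul, div_mul_cancel₀ _ hk'.ne']
  exact h k

theorem meanPayoff_le {π : ℕ → V} {r C : ℝ}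
    (h : ∀ k : ℕ, G.prefixPayoff π k ≤ r * k + C) : G.meanPayoff π ≤ (r : EReal) := by
  rw [← (tendsto_add_div r C).liminf_eq]
  refine liminf_le_liminf ?_
  filter_upwards [eventually_gt_atTop 0] with k hk
  have hk' : (0 : ℝ) < k := by exact_mod_cast hk
  rw [EReal.coe_le_coe_iff, div_le_iff₀ hk', add_mul, div_mul_cancel₀ _ hk'.ne']
  exact h k

theorem accSum_rescale (G : WeightedGraph V) (p q : ℤ) (π : ℕ → V) (k : ℕ) :
    accSum (fun u v => q * G.weight u v - p) π k = q * G.prefixPayoff π k - k * p := by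
  simp [accSum, prefixPayoff, Finset.sum_sub_distrib, Finset.mul_sum]

/-- The mean payoff for the weights `q * w - p` is negative exactly if the one for `w` is less than
`p / q`. -/
theorem upperValue_meanPayoff_lt [Finite V] {p q : ℤ} (hq : 0 < q) {v : V}
    (hv : G.ForcesUnbounded (fun u v => q * G.weight u v - p) v) :
    G.upperValue G.meanPayoff v < ((p / q : ℝ) : EReal) := by
  obtain ⟨K, C, τ, hK, hτ⟩ := hv.exists_strategy
  have hq' : (0 : ℝ) < q := by exact_mod_cast hq
  have hK' : (0 : ℝ) < K := by exact_mod_cast hK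
  refine lt_of_le_of_lt (b := ((p / q - 1 / (K * q) : ℝ) : EReal)) ?_ ?_
  · refine iInf_le_of_le τ (iSup_le fun σ => meanPayoff_le (C := C / (K * q)) fun k => ?_)
    have h := hτ σ k
    rw [accSum_rescale] at h
    have h' : (K : ℝ) * (q * G.prefixPayoff (outcome σ τ v) k - k * p) ≤ C - k := by
      exact_mod_cast h
    have : (p / q - 1 / (K * q) : ℝ) * k + C / (K * q) = (K * (k * p) + (C - k)) / (K * q) := by
      field_simp
      ring
    rw [this, le_div_iff₀ (by positivity)]
    linarith
  · rw [EReal.coe_lt_coe_iff]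
    have : (0 : ℝ) < 1 / (K * q) := by positivity
    linarith

theorem le_lowerValue_meanPayoff [Finite V] {p q : ℤ} (hq : 0 < q) {v : V}
    (hv : ¬ G.ForcesUnbounded (fun u v => q * G.weight u v - p) v) :
    ((p / q : ℝ) : EReal) ≤ G.lowerValue G.meanPayoff v := by
  obtain ⟨C, σ, hσ⟩ := exists_max_strategy_of_not_forcesUnbounded hv
  have hq' : (0 : ℝ) < q := by exact_mod_cast hq
  refine le_iSup_of_le σ (le_iInf fun τ => le_meanPayoff (C := C / q) fun k => ?_)
  have h := hσ τ k
  rw [accSum_rescale] at h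
  have h' : (C : ℝ) < q * G.prefixPayoff (outcome σ τ v) k - k * p := by exact_mod_cast h
  rw [div_mul_eq_mul_div, ← add_div, div_le_iff₀ hq']
  linarith

/-- Mean-payoff games are determined: a rational number strictly between the lower and the upper
value would be a threshold that neither player can enforce. -/
theorem exists_hasValue_meanPayoff [Finite V] (G : WeightedGraph V) (v : V) :
    ∃ y, G.HasValue G.meanPayoff v y ∧ (y < 0 ↔ G.ForcesUnbounded G.weight v) := by
  have hle : G.upperValue G.meanPayoff v ≤ G.lowerValue G.meanPayoff v := by
    by_contra! hlt
    obtain ⟨r, hr1, hr2⟩ := EReal.lt_iff_exists_rat_btwn.1 hlt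
    have hq : (0 : ℤ) < r.den := by exact_mod_cast r.den_pos
    have hr : ((r.num / (r.den : ℤ) : ℝ) : EReal) = ((r : ℝ) : EReal) := by
      rw [Int.cast_natCast, ← Rat.cast_def]
    by_cases hv : G.ForcesUnbounded (fun u v => r.den * G.weight u v - r.num) v
    · have := upperValue_meanPayoff_lt hq hv
      rw [hr] at this
      exact absurd hr2 this.not_gt
    · have := le_lowerValue_meanPayoff hq hv
      rw [hr] at this
      exact absurd hr1 this.not_gt
  refine ⟨_, hasValue_of_le le_rfl hle, fun h => ?_, fun h => ?_⟩
  · by_contra hv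
    have := le_lowerValue_meanPayoff (p := 0) one_pos (v := v) (G := G) (by simpa using hv)
    simp at this
    exact absurd h this.not_gt
  · have := upperValue_meanPayoff_lt (p := 0) one_pos (v := v) (G := G) (by simpa using h)
    simp at this
    exact (G.lowerValue_le_upperValue _ _).trans_lt this

/-! ### Comparison of the two games on one graph -/

/-- If Min can force a visit of the target from everywhere, then Min can do so after having forced
a small accumulated weight. -/
theorem reachesAtMost_iff_forcesUnbounded [Finite V] (hT : ∀ u, ∃ N, G.ReachesAtMost T N u)
    (v : V) : (∀ N, G.ReachesAtMost T N v) ↔ G.ForcesUnbounded G.weight v := by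
  refine ⟨fun h C => (h C).imp fun _ h => h.mono fun _ _ h => h.2, fun h N => ?_⟩
  choose M hM using hT
  obtain ⟨B, hB⟩ := (Set.finite_range M).bddAbove
  obtain ⟨K, hK⟩ := exists_uniform (p := fun _ => True)
    (q := fun k u => G.Attr G.weight (fun u t => u ∈ T ∧ t ≤ B) k u 0)
    (fun _ _ _ hkl h => h.le hkl) fun u _ => (hM u).mono (hB ⟨u, rfl⟩)
  obtain ⟨k, hk⟩ := h (N - B)
  refine ⟨k + K, hk.trans fun u t ht => ?_⟩
  have := (hK u trivial).shift (Z' := fun u t => u ∈ T ∧ t ≤ N) t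
    fun u s h => ⟨h.1, by have := h.2; omega⟩
  rwa [zero_add] at this

theorem exists_hasValue_eq_bot_iff [Finite V] (G : WeightedGraph V) (T : Set V) (hT : G.IsSink T)
    (htop : ∀ u, ¬ G.HasValue (G.mcrPayoff T) u ⊤) (v : V) :
    ∃ x y : EReal, G.HasValue (G.mcrPayoff T) v x ∧ G.HasValue G.meanPayoff v y ∧
      (x = ⊥ ↔ y < 0) := by
  obtain ⟨x, hx, hx'⟩ := hT.exists_hasValue v
  obtain ⟨y, hy, hy'⟩ := G.exists_hasValue_meanPayoff v
  refine ⟨x, y, hx, hy, ?_⟩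
  rw [hx', hy', reachesAtMost_iff_forcesUnbounded fun u => ?_]
  by_contra h
  exact htop u (hasValue_top (not_exists.1 h))

end WeightedGraph

namespace WeightedGraph

variable {V : Type*}

/-! ### From mean payoffs to reachability -/

/-- The min-cost reachability game of a mean-payoff game: every vertex `v` is split into
`some (.inl v)`, where Min either stops by moving to the target `none` or continues to
`some (.inr v)`, and `some (.inr v)`, where the owner of `v` chooses among the edges of `v`. -/
def stopping [DecidableEq V] (G : WeightedGraph V) : WeightedGraph (Option (V ⊕ V)) where
  owner
    | some (.inr v) => G.owner v
    | _ => .min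
  edge
    | none, none => some 0
    | some (.inl _), none => some 0
    | some (.inl v), some (.inr u) => if v = u then some 0 else none
    | some (.inr v), some (.inl u) => G.edge v u
    | _, _ => none
  deadlockFree
    | none => ⟨none, rfl⟩
    | some (.inl _) => ⟨none, rfl⟩
    | some (.inr v) => (G.deadlockFree v).elim fun u hu => ⟨some (.inl u), hu⟩

section stopping

variable [DecidableEq V] (G : WeightedGraph V)

theorem stopping_isSink : G.stopping.IsSink {none} := by
  rintro _ rfl
  refine ⟨rfl, ?_⟩
  rintro (_ | v | v) hv
  · exact absurd rfl hv
  · rfl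
  · rfl

/-- Min stops at once. -/
theorem stopping_attr_inl {N : ℤ} {v : V} {s : ℤ} (hs : s ≤ N) :
    G.stopping.Attr G.stopping.weight (fun u t => u ∈ ({none} : Set _) ∧ t ≤ N) 1
      (some (.inl v)) s :=
  Or.inr ⟨fun _ => ⟨none, rfl, rfl, by simpa [weight, stopping] using hs⟩,
    fun h => absurd rfl h⟩

/-- A move from `v` in `G` is simulated by two moves: Min continues, and the owner of `v` moves. -/
theorem stopping_forces_inl {P : Option (V ⊕ V) → ℤ → Prop} {v : V} {s : ℤ} (k : ℕ)
    (h : G.Forces .min G.weight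
      (fun u t => G.stopping.Attr G.stopping.weight P k (some (.inl u)) t) v s) :
    G.stopping.Attr G.stopping.weight P (k + 1) (some (.inr v)) s := by
  refine Or.inr ⟨fun hp => ?_, fun hp u hu => ?_⟩
  · obtain ⟨u, hu, h⟩ := h.1 hp
    exact ⟨some (.inl u), hu, h⟩
  · rcases u with _ | u | u
    · simp [IsEdge, stopping] at hu
    · exact h.2 hp u hu
    · simp [IsEdge, stopping] at hu

theorem stopping_attr_inl_of_inr {P : Option (V ⊕ V) → ℤ → Prop} {v : V} {s : ℤ} {k : ℕ}
    (h : G.stopping.Attr G.stopping.weight P k (some (.inr v)) s) :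
    G.stopping.Attr G.stopping.weight P (k + 1) (some (.inl v)) s :=
  Or.inr ⟨fun _ => ⟨some (.inr v), by simp [IsEdge, stopping], by simpa [weight, stopping] using h⟩,
    fun h => absurd rfl h⟩

theorem stopping_exists_reachesAtMost [Finite V] :
    ∀ v, ∃ N, G.stopping.ReachesAtMost {none} N v
  | none => ⟨0, 0, rfl, le_rfl⟩
  | some (.inl _) => ⟨0, 1, G.stopping_attr_inl le_rfl⟩
  | some (.inr v) => by
    obtain ⟨B, hB⟩ := exists_abs_le G.weight
    have h : ∀ u, G.stopping.Attr G.stopping.weight (fun u t => u ∈ ({none} : Set _) ∧ t ≤ B) 1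
        (some (.inl u)) (0 + G.weight v u) :=
      fun u => G.stopping_attr_inl (by have := (abs_le.1 (hB v u)).2; omega)
    exact ⟨B, 2, G.stopping_forces_inl 1
      ⟨fun _ => (G.deadlockFree v).imp fun u hu => ⟨hu, h u⟩, fun _ u _ => h u⟩⟩

/-- Min can force small payoffs in the new game exactly if Min can force small accumulated weights
in the old one: Min then stops, and Max can keep a lower bound on the weights at which Min stops. -/
theorem stopping_reachesAtMost_iff [Finite V] (v : V) :
    (∀ N, G.stopping.ReachesAtMost {none} N (some (.inl v))) ↔ G.ForcesUnbounded G.weight v := by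
  refine forall_congr' fun N => ⟨fun ⟨K, hK⟩ => ?_, fun ⟨k, hk⟩ => ?_⟩
  · by_contra hc
    rw [not_exists] at hc
    -- Max can keep the states from which Min cannot force a weight of at most `N` in `G`
    set S : V → ℤ → Prop := fun u t => ∀ k, ¬ G.Attr G.weight (fun _ t => t ≤ N) k u t
    refine not_attr_of_invariant (P := fun u t => match u with
      | none => N < t
      | some (.inl u) => S u t
      | some (.inr u) => S u t) ?_ ?_ K hc hK
    · rintro (_ | u | u) t h
      · exact G.stopping_isSink.forces rfl h
      · refine ⟨fun hp => ?_, ?_⟩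
        · simp [stopping] at hp
        · rintro - (_ | u' | u') hu'
          · simpa [weight, stopping] using not_le.1 (h 0)
          · simp [IsEdge, stopping] at hu'
          · obtain rfl : u = u' := by
              by_contra hne
              simp [IsEdge, stopping, hne] at hu'
            simpa [weight, stopping] using h
      · have h' := forces_max_not_attr h
        refine ⟨fun hp => ?_, fun hp u' hu' => ?_⟩
        · obtain ⟨u', hu', h'⟩ := h'.1 hp
          exact ⟨some (.inl u'), hu', h'⟩
        · rcases u' with _ | u' | u'
          · simp [IsEdge, stopping] at hu'
          · exact h'.2 hp u' hu'
          · simp [IsEdge, stopping] at hu'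
    · rintro u t h ⟨rfl, ht⟩
      exact (not_le.2 h) ht
  · have : ∀ k (u : V) (t : ℤ), G.Attr G.weight (fun _ t => t ≤ N) k u t →
        G.stopping.Attr G.stopping.weight (fun u t => u ∈ ({none} : Set _) ∧ t ≤ N) (2 * k + 1)
          (some (.inl u)) t := by
      intro k
      induction k with
      | zero => exact fun u t h => G.stopping_attr_inl h
      | succ k ih =>
        rintro u t (h | h)
        · exact (G.stopping_attr_inl h).le (by omega)
        · exact G.stopping_attr_inl_of_inr
            (G.stopping_forces_inl _ (h.of_step fun u' _ h' => ih u' _ h'))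
    exact ⟨_, this k v 0 hk⟩

end stopping

/-- The weighted graph with its vertices renamed. -/
def comap {W : Type*} (e : W ≃ V) (G : WeightedGraph V) : WeightedGraph W where
  owner w := G.owner (e w)
  edge w w' := G.edge (e w) (e w')
  deadlockFree w := (G.deadlockFree (e w)).elim fun v hv => ⟨e.symm v, by simpa using hv⟩

section comap

variable {W : Type*} (e : W ≃ V) {G : WeightedGraph V}

theorem comap_attr {ω : V → V → ℤ} {Z : V → ℤ → Prop} {k : ℕ} : ∀ {w : W} {s : ℤ},
    (G.comap e).Attr (fun w w' => ω (e w) (e w')) (fun w t => Z (e w) t) k w s ↔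
      G.Attr ω Z k (e w) s := by
  induction k with
  | zero => exact Iff.rfl
  | succ k ih =>
    intro w s
    refine or_congr_right (and_congr (imp_congr_right fun _ => ?_) (imp_congr_right fun _ => ?_))
    · rw [e.surjective.exists]
      exact exists_congr fun u => and_congr_right fun _ => ih
    · rw [e.surjective.forall]
      exact forall_congr' fun u => imp_congr_right fun _ => ih

theorem comap_reachesAtMost {t : W} {t' : V} (ht : e t = t') {N : ℤ} {w : W} :
    (G.comap e).ReachesAtMost {t} N w ↔ G.ReachesAtMost {t'} N (e w) := by
  refine exists_congr fun k => Iff.trans ?_ (comap_attr (ω := G.weight) e)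
  simp only [Set.mem_singleton_iff, ← ht, EmbeddingLike.apply_eq_iff_eq]
  rfl

theorem comap_isSink {t : W} {t' : V} (ht : e t = t') (h : G.IsSink {t'}) :
    (G.comap e).IsSink {t} := by
  subst ht
  rintro _ rfl
  exact ⟨(h _ rfl).1, fun v hv => (h _ rfl).2 _ (e.injective.ne hv)⟩

end comap

end WeightedGraph

/-- The vertices of the reachability game are numbered with the stopping copies first and the target
last. -/
def vertexEquiv (n : ℕ) : Fin (n + n + 1) ≃ Option (Fin n ⊕ Fin n) :=
  (finSumFinEquiv.optionCongr.trans finSuccEquivLast.symm).symm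

@[simp]
theorem vertexEquiv_last (n : ℕ) : vertexEquiv n (Fin.last (n + n)) = none := by
  rw [vertexEquiv, Equiv.symm_apply_eq]
  simp

@[simp]
theorem vertexEquiv_castAdd {n : ℕ} (v : Fin n) :
    vertexEquiv n (Fin.castAdd n v).castSucc = some (.inl v) := by
  rw [vertexEquiv, Equiv.symm_apply_eq]
  simp

@[simp]
theorem vertexEquiv_natAdd {n : ℕ} (v : Fin n) :
    vertexEquiv n (Fin.natAdd n v).castSucc = some (.inr v) := by
  rw [vertexEquiv, Equiv.symm_apply_eq]
  simp

/-- The reduction of mean-payoff games to min-cost reachability games. -/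
def MPInstance.toMCR (I : MPInstance) : MCRInstance where
  n := I.n + I.n + 1
  graph := I.graph.stopping.comap (vertexEquiv I.n)
  target := Fin.last _

theorem MPInstance.toMCR_isSink (I : MPInstance) : I.toMCR.graph.IsSink {I.toMCR.target} :=
  WeightedGraph.comap_isSink _ (vertexEquiv_last I.n) I.graph.stopping_isSink

theorem MPInstance.toMCR_reachesAtMost (I : MPInstance) {N : ℤ} {u : Fin I.toMCR.n} :
    I.toMCR.graph.ReachesAtMost {I.toMCR.target} N u ↔
      I.graph.stopping.ReachesAtMost {none} N (vertexEquiv I.n u) :=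
  WeightedGraph.comap_reachesAtMost _ (vertexEquiv_last I.n)

theorem MPInstance.toMCR_not_hasValue_top (I : MPInstance) (u : Fin I.toMCR.n) :
    ¬ I.toMCR.graph.HasValue (I.toMCR.graph.mcrPayoff {I.toMCR.target}) u ⊤ := by
  obtain ⟨N, hN⟩ := I.graph.stopping_exists_reachesAtMost (vertexEquiv I.n u)
  exact WeightedGraph.not_hasValue_top I.toMCR_isSink (I.toMCR_reachesAtMost.2 hN)

theorem MPInstance.exists_hasValue_toMCR (I : MPInstance) (h : I.n ≤ I.toMCR.n) (v : Fin I.n) :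
    ∃ x y : EReal, I.graph.HasValue I.graph.meanPayoff v x ∧
      I.toMCR.graph.HasValue (I.toMCR.graph.mcrPayoff {I.toMCR.target}) (Fin.castLE h v) y ∧
      (x < 0 ↔ y = ⊥) := by
  obtain ⟨x, hx, hx'⟩ := I.graph.exists_hasValue_meanPayoff v
  obtain ⟨y, hy, hy'⟩ := I.toMCR_isSink.exists_hasValue (Fin.castLE h v)
  refine ⟨x, y, hx, hy, ?_⟩
  rw [hx', hy', ← WeightedGraph.stopping_reachesAtMost_iff]
  simp only [toMCR_reachesAtMost]
  rw [show Fin.castLE h v = (Fin.castAdd I.n v).castSucc from rfl, vertexEquiv_castAdd]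

/-! ### The word that describes the reachability game -/

/-- The row of the stopping copy of the vertex `v`: its edges go to the other copy of `v` and to the
target. -/
def stoppingRow (n v : ℕ) : List Letter :=
  .minVertex :: (List.replicate n .noEdge ++
    (List.replicate v .noEdge ++ .plus :: List.replicate (n - 1 - v) .noEdge) ++ [.plus])

/-- The row of the vertex `v` of a mean-payoff game. -/
def MPInstance.row (I : MPInstance) (v : Fin I.n) : List Letter :=
  encodePlayer (I.graph.owner v) ::
    (List.finRange I.n).flatMap fun u => encodeEntry (I.graph.edge v u)

theorem MPInstance.encode_eq (I : MPInstance) :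
    I.encode = (List.finRange I.n).flatMap I.row := by
  simp only [encode, encodeGraph, Bool.false_eq_true, if_false, List.nil_append]
  rfl

theorem finRange_add (n m : ℕ) : List.finRange (n + m) =
    (List.finRange n).map (Fin.castAdd m) ++ (List.finRange m).map (Fin.natAdd n) := by
  rw [← List.ofFn_id, List.ofFn_add, List.ofFn_eq_map, List.ofFn_eq_map]
  rfl

theorem flatMap_const {α : Type*} (l : List α) (x : Letter) :
    (l.flatMap fun _ => [x]) = List.replicate l.length x := by
  induction l with
  | nil => rfl
  | cons a l ih => simp [ih, List.replicate_succ]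

theorem flatMap_ite_eq {n : ℕ} (v : Fin n) (x y : Letter) :
    ((List.finRange n).flatMap fun u => if v = u then [x] else [y]) =
      List.replicate v y ++ x :: List.replicate (n - 1 - v) y := by
  induction n with
  | zero => exact v.elim0
  | succ n ih =>
    rw [List.finRange_succ, List.flatMap_cons, List.flatMap_map]
    refine Fin.cases ?_ (fun v => ?_) v
    · simp [Fin.succ_ne_zero, eq_comm, flatMap_const]
    · simp only [Fin.succ_inj, ih v, Fin.succ_ne_zero, if_false, Fin.val_succ, List.replicate_succ]
      simp
      omega

/-- The rows of the stopping copies, of the other copies, and of the target. -/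
theorem MPInstance.encode_toMCR (I : MPInstance) :
    I.toMCR.encode = (List.range I.n).flatMap (stoppingRow I.n) ++
      ((List.finRange I.n).flatMap fun v => I.row v ++ (List.replicate I.n .noEdge ++ [.noEdge])) ++
      .minVertex :: .targetMark :: (List.replicate I.n .noEdge ++
        (List.replicate I.n .noEdge ++ [.plus])) := by
  have h1 : ∀ v : Fin I.n, ¬ (Fin.castAdd I.n v).castSucc = Fin.last (I.n + I.n) :=
    fun v => (Fin.castSucc_lt_last _).ne
  have h2 : ∀ v : Fin I.n, ¬ (Fin.natAdd I.n v).castSucc = Fin.last (I.n + I.n) :=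
    fun v => (Fin.castSucc_lt_last _).ne
  rw [← List.map_coe_finRange_eq_range, List.flatMap_map]
  simp only [MCRInstance.encode, encodeGraph, toMCR, List.finRange_succ_last, finRange_add,
    List.map_append, List.map_map, List.flatMap_append, List.flatMap_map, Function.comp_apply,
    List.flatMap_cons, List.flatMap_nil, WeightedGraph.comap,
    vertexEquiv_last, vertexEquiv_castAdd, vertexEquiv_natAdd, WeightedGraph.stopping, h1, h2,
    decide_false, decide_true, apply_ite encodeEntry]
  have hzero : encodeEntry (some 0) = [.plus] := by simp [encodeEntry]
  have hnone : encodeEntry none = [.noEdge] := rfl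
  simp only [hzero, hnone, flatMap_const, flatMap_ite_eq, List.length_finRange]
  simp [encodePlayer, stoppingRow, row, -List.replicate_append_replicate]

/-! ### The Turing machine -/

open Turing

/-- The stacks of the machine: the input, its reversal, the output, and four counters. -/
inductive Stack where
  | input
  | reversed
  | output
  | a
  | b
  | c
  | d
  deriving DecidableEq

instance : Fintype Stack where
  elems := {.input, .reversed, .output, .a, .b, .c, .d}
  complete x := by cases x <;> decide

/-- The labels of the program: `tally` reverses the input and counts the vertices, `target₁` and
`target₂` write the row of the target, the next four labels write the rows of the copies where the
owner moves, the next five those of the copies where Min can stop, and `clear` empties the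
counter. -/
inductive Label where
  | tally
  | target₁
  | target₂
  | row
  | row₁
  | row₂
  | rowCopy
  | minRow
  | minRow₁
  | minRow₂
  | minRow₃
  | minRow₄
  | clear
  deriving DecidableEq

instance : Fintype Label where
  elems := {.tally, .target₁, .target₂, .row, .row₁, .row₂, .rowCopy, .minRow, .minRow₁, .minRow₂,
    .minRow₃, .minRow₄, .clear}
  complete x := by cases x <;> decide

/-- Programs. The internal state holds the last letter that was read. -/
abbrev Program : Type := TM2.Stmt (fun _ : Stack => Letter) Label (Option Letter)

open TM2.Stmt in
/-- One round of the loop `l` that moves the counter `x` to the counter `y`, does `q` for every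
unit, and continues with `done`. -/
def moveCounter (x y : Stack) (l : Label) (q : Program → Program) (done : Program) : Program :=
  pop x (fun _ z => z) (branch Option.isNone done (push y (fun _ => .noEdge) (q (goto fun _ => l))))

/-- Write the letter `z`. -/
def write (z : Letter) : Program → Program := TM2.Stmt.push .output fun _ => z

open TM2.Stmt in
/-- The program of the machine. The output is a stack, so the word is written from its end. Let `n`
be the number of vertices. Up to the rows of the copies where the owner moves, the counter `a` holds
`n`, and it is moved to `b` and back in order to write `n` missing edges. While the row of the
stopping copy of `v` is written, the counters `a` and `b` hold `v` and `n - 1 - v`. They are moved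
to `d` and `c`, which writes the missing edges on both sides of the edge to the other copy, and
back, which writes, with one more letter, the `n` missing edges to the stopping
copies. -/
def program : Label → Program
  | .tally => pop .input (fun _ z => z) <|
      branch Option.isNone (write .plus (goto fun _ => .target₁)) <|
      push .reversed (fun z => z.getD .noEdge) <|
      branch (fun z => (z.getD .noEdge).opensRow)
        (push .a (fun _ => .noEdge) (goto fun _ => .tally)) (goto fun _ => .tally)
  | .target₁ => moveCounter .a .b .target₁ (write .noEdge) (goto fun _ => .target₂)
  | .target₂ => moveCounter .b .a .target₂ (write .noEdge)
      (write .targetMark <| write .minVertex <| goto fun _ => .row)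
  | .row => peek .reversed (fun _ z => z) <| branch Option.isNone (goto fun _ => .minRow)
      (write .noEdge (goto fun _ => .row₁))
  | .row₁ => moveCounter .a .b .row₁ (write .noEdge) (goto fun _ => .row₂)
  | .row₂ => moveCounter .b .a .row₂ id (goto fun _ => .rowCopy)
  | .rowCopy => pop .reversed (fun _ z => z) <| push .output (fun z => z.getD .noEdge) <|
      branch (fun z => (z.getD .noEdge).opensRow) (goto fun _ => .row) (goto fun _ => .rowCopy)
  | .minRow => pop .a (fun _ z => z) <| branch Option.isNone (goto fun _ => .clear)
      (write .plus (goto fun _ => .minRow₁))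
  | .minRow₁ => moveCounter .b .c .minRow₁ (write .noEdge) (write .plus (goto fun _ => .minRow₂))
  | .minRow₂ => moveCounter .a .d .minRow₂ (write .noEdge) (write .noEdge (goto fun _ => .minRow₃))
  | .minRow₃ => moveCounter .c .b .minRow₃ (write .noEdge) (goto fun _ => .minRow₄)
  | .minRow₄ => moveCounter .d .a .minRow₄ (write .noEdge)
      (write .minVertex <| push .b (fun _ => .noEdge) <| goto fun _ => .minRow)
  | .clear => pop .b (fun _ z => z) <| branch Option.isNone halt (goto fun _ => .clear)

/-- The machine that computes the reduction. -/
def reductionMachine : FinTM2 where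
  K := Stack
  k₀ := .input
  k₁ := .output
  Γ _ := Letter
  Λ := Label
  main := .tally
  σ := Option Letter
  initialState := none
  Γk₀Fin := inferInstanceAs (Fintype Letter)
  m := program

/-! ### Runs of the machine -/

/-- The contents of the stacks; a counter holds a number in unary. -/
def contents (i r o : List Letter) (a b c d : ℕ) : Stack → List Letter
  | .input => i
  | .reversed => r
  | .output => o
  | .a => .replicate a .noEdge
  | .b => .replicate b .noEdge
  | .c => .replicate c .noEdge
  | .d => .replicate d .noEdge

section update

variable (i r o x : List Letter) (a b c d k : ℕ)

@[simp]
theorem update_input :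
    Function.update (contents i r o a b c d) .input x = contents x r o a b c d := by
  funext k; cases k <;> simp [contents]

@[simp]
theorem update_reversed :
    Function.update (contents i r o a b c d) .reversed x = contents i x o a b c d := by
  funext k; cases k <;> simp [contents]

@[simp]
theorem update_output :
    Function.update (contents i r o a b c d) .output x = contents i r x a b c d := by
  funext k; cases k <;> simp [contents]

@[simp]
theorem update_a : Function.update (contents i r o a b c d) .a (.replicate k .noEdge) =
    contents i r o k b c d := by
  funext k; cases k <;> simp [contents]

@[simp]
theorem update_b : Function.update (contents i r o a b c d) .b (.replicate k .noEdge) =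
    contents i r o a k c d := by
  funext k; cases k <;> simp [contents]

@[simp]
theorem update_c : Function.update (contents i r o a b c d) .c (.replicate k .noEdge) =
    contents i r o a b k d := by
  funext k; cases k <;> simp [contents]

@[simp]
theorem update_d : Function.update (contents i r o a b c d) .d (.replicate k .noEdge) =
    contents i r o a b c k := by
  funext k; cases k <;> simp [contents]

@[simp]
theorem update_a_nil : Function.update (contents i r o a b c d) .a [] =
    contents i r o 0 b c d :=
  update_a i r o a b c d 0

@[simp]
theorem update_b_nil : Function.update (contents i r o a b c d) .b [] =
    contents i r o a 0 c d :=
  update_b i r o a b c d 0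

@[simp]
theorem update_d_nil : Function.update (contents i r o a b c d) .d [] =
    contents i r o a b c 0 :=
  update_d i r o a b c d 0

end update

/-- The configurations of the machine. -/
abbrev Config : Type := TM2.Cfg (fun _ : Stack => Letter) Label (Option Letter)

/-- The machine gets from `x` to `y` in at most `t` steps. -/
def Runs (x y : Config) (t : ℕ) : Prop :=
  Nonempty (StateTransition.EvalsToInTime (TM2.step program) x (some y) t)

theorem Runs.refl (x : Config) : Runs x x 0 := ⟨.refl _ _⟩

theorem Runs.trans {x y z : Config} {s t : ℕ} (h₁ : Runs x y s) (h₂ : Runs y z t) :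
    Runs x z (s + t) := by
  obtain ⟨h₁⟩ := h₁
  obtain ⟨h₂⟩ := h₂
  rw [add_comm]
  exact ⟨.trans _ _ _ _ _ _ h₁ h₂⟩

theorem Runs.mono {x y : Config} {s t : ℕ} (h : Runs x y s) (hst : s ≤ t) : Runs x y t := by
  obtain ⟨h⟩ := h
  exact ⟨⟨h.toEvalsTo, h.steps_le_m.trans hst⟩⟩

theorem Runs.step {l : Label} {v : Option Letter} {S : Stack → List Letter} {y : Config} {t : ℕ}
    (h : Runs (TM2.stepAux (program l) v S) y t) : Runs ⟨some l, v, S⟩ y (t + 1) := by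
  rw [add_comm]
  refine Runs.trans (y := TM2.stepAux (program l) v S) ⟨⟨⟨1, rfl⟩, le_rfl⟩⟩ h

theorem cons_replicate (k : ℕ) (x : Letter) :
    x :: List.replicate k x = List.replicate (k + 1) x := rfl

theorem head?_replicate_succ (k : ℕ) (x : Letter) :
    (List.replicate (k + 1) x).head? = some x := rfl

/-- A loop that decreases a counter `m`, increases a counter `k` and writes `z` in each round. -/
theorem runs_loop {l : Label} {z : List Letter} {S : List Letter → ℕ → ℕ → Stack → List Letter}
    {y : List Letter → ℕ → Config} (h0 : ∀ v o k, TM2.stepAux (program l) v (S o 0 k) = y o k)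
    (hs : ∀ v o m k, TM2.stepAux (program l) v (S o (m + 1) k) =
      ⟨some l, some .noEdge, S (z ++ o) m (k + 1)⟩) (m : ℕ) :
    ∀ v o k, Runs ⟨some l, v, S o m k⟩ (y ((List.replicate m z).flatten ++ o) (k + m)) (m + 1) := by
  induction m with
  | zero => exact fun v o k => Runs.step (by rw [h0]; exact .refl _)
  | succ m ih =>
    intro v o k
    refine Runs.step ?_
    rw [hs]
    convert ih (some .noEdge) (z ++ o) (k + 1) using 2
    · rw [List.replicate_succ', List.flatten_append]
      simp
    · omega

theorem runs_tally (w : List Letter) : ∀ v r a, Runs ⟨some .tally, v, contents w r [] a 0 0 0⟩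
    ⟨some .target₁, none, contents [] (w.reverse ++ r) [.plus] (a + w.countP Letter.opensRow) 0 0 0⟩
    (w.length + 1) := by
  induction w with
  | nil =>
    intro v r a
    refine .step ?_
    simp only [program, write, contents, TM2.stepAux, update_input, update_output, List.head?_nil,
      List.tail_nil, Option.isNone_none, cond_true]
    exact .refl _
  | cons x w ih =>
    intro v r a
    refine .step ?_
    cases hx : x.opensRow
    · simpa [program, write, contents, hx] using ih (some x) (x :: r) a
    · simpa [program, write, contents, hx, cons_replicate, add_assoc, add_comm 1]
        using ih (some x) (x :: r) (a + 1)

section loops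

variable (i r o : List Letter) (a b c d : ℕ) (v : Option Letter)

theorem runs_target₁ : Runs ⟨some .target₁, v, contents i r o a b c d⟩
    ⟨some .target₂, none, contents i r (List.replicate a .noEdge ++ o) 0 (b + a) c d⟩ (a + 1) := by
  simpa using runs_loop (l := .target₁) (z := [.noEdge])
    (S := fun o a b => contents i r o a b c d)
    (y := fun o b => ⟨some .target₂, none, contents i r o 0 b c d⟩)
    (by simp [program, moveCounter, contents])
    (by simp [program, moveCounter, write, contents, cons_replicate, head?_replicate_succ]) a v o b

theorem runs_target₂ : Runs ⟨some .target₂, v, contents i r o a b c d⟩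
    ⟨some .row, none, contents i r (.minVertex :: .targetMark :: (List.replicate b .noEdge ++ o))
      (a + b) 0 c d⟩ (b + 1) := by
  simpa using runs_loop (l := .target₂) (z := [.noEdge])
    (S := fun o b a => contents i r o a b c d)
    (y := fun o a => ⟨some .row, none,
      contents i r (.minVertex :: .targetMark :: o) a 0 c d⟩)
    (by simp [program, moveCounter, write, contents])
    (by simp [program, moveCounter, write, contents, cons_replicate, head?_replicate_succ]) b v o a

theorem runs_row₁ : Runs ⟨some .row₁, v, contents i r o a b c d⟩
    ⟨some .row₂, none, contents i r (List.replicate a .noEdge ++ o) 0 (b + a) c d⟩ (a + 1) := by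
  simpa using runs_loop (l := .row₁) (z := [.noEdge])
    (S := fun o a b => contents i r o a b c d)
    (y := fun o b => ⟨some .row₂, none, contents i r o 0 b c d⟩)
    (by simp [program, moveCounter, contents])
    (by simp [program, moveCounter, write, contents, cons_replicate, head?_replicate_succ]) a v o b

theorem runs_row₂ : Runs ⟨some .row₂, v, contents i r o a b c d⟩
    ⟨some .rowCopy, none, contents i r o (a + b) 0 c d⟩ (b + 1) := by
  simpa using runs_loop (l := .row₂) (z := [])
    (S := fun o b a => contents i r o a b c d)
    (y := fun o a => ⟨some .rowCopy, none, contents i r o a 0 c d⟩)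
    (by simp [program, moveCounter, contents])
    (by simp [program, moveCounter, contents, cons_replicate, head?_replicate_succ]) b v o a

theorem runs_minRow₁ : Runs ⟨some .minRow₁, v, contents i r o a b c d⟩
    ⟨some .minRow₂, none, contents i r (.plus :: (List.replicate b .noEdge ++ o)) a 0 (c + b) d⟩
    (b + 1) := by
  simpa using runs_loop (l := .minRow₁) (z := [.noEdge])
    (S := fun o b c => contents i r o a b c d)
    (y := fun o c => ⟨some .minRow₂, none, contents i r (.plus :: o) a 0 c d⟩)
    (by simp [program, moveCounter, write, contents])
    (by simp [program, moveCounter, write, contents, cons_replicate, head?_replicate_succ]) b v o c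

theorem runs_minRow₂ : Runs ⟨some .minRow₂, v, contents i r o a b c d⟩
    ⟨some .minRow₃, none, contents i r (.noEdge :: (List.replicate a .noEdge ++ o)) 0 b c (d + a)⟩
    (a + 1) := by
  simpa using runs_loop (l := .minRow₂) (z := [.noEdge])
    (S := fun o a d => contents i r o a b c d)
    (y := fun o d => ⟨some .minRow₃, none, contents i r (.noEdge :: o) 0 b c d⟩)
    (by simp [program, moveCounter, write, contents])
    (by simp [program, moveCounter, write, contents, cons_replicate, head?_replicate_succ]) a v o d

theorem runs_minRow₃ : Runs ⟨some .minRow₃, v, contents i r o a b c d⟩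
    ⟨some .minRow₄, none, contents i r (List.replicate c .noEdge ++ o) a (b + c) 0 d⟩ (c + 1) := by
  simpa using runs_loop (l := .minRow₃) (z := [.noEdge])
    (S := fun o c b => contents i r o a b c d)
    (y := fun o b => ⟨some .minRow₄, none, contents i r o a b 0 d⟩)
    (by simp [program, moveCounter, contents])
    (by simp [program, moveCounter, write, contents, cons_replicate, head?_replicate_succ]) c v o b

theorem runs_minRow₄ : Runs ⟨some .minRow₄, v, contents i r o a b c d⟩
    ⟨some .minRow, none, contents i r (.minVertex :: (List.replicate d .noEdge ++ o))
      (a + d) (b + 1) c 0⟩ (d + 1) := by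
  simpa using runs_loop (l := .minRow₄) (z := [.noEdge])
    (S := fun o d a => contents i r o a b c d)
    (y := fun o a => ⟨some .minRow, none, contents i r (.minVertex :: o) a (b + 1) c 0⟩)
    (by simp [program, moveCounter, write, contents, cons_replicate])
    (by simp [program, moveCounter, write, contents, cons_replicate, head?_replicate_succ]) d v o a

theorem runs_clear (b : ℕ) : ∀ v, Runs ⟨some .clear, v, contents i r o a b c d⟩
    ⟨none, none, contents i r o a 0 c d⟩ (b + 1) := by
  induction b with
  | zero =>
    refine fun v => .step ?_
    simpa [program, contents] using Runs.refl _
  | succ b ih =>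
    refine fun v => .step ?_
    simpa [program, contents, head?_replicate_succ] using ih (some .noEdge)

/-- The letters of the reversed word are written up to the next one that opens a row. -/
theorem runs_rowCopy {p : Letter} (hp : p.opensRow = true) {q : List Letter} :
    ∀ v o, (∀ z ∈ q, z.opensRow = false) →
      Runs ⟨some .rowCopy, v, contents i (q ++ p :: r) o a b c d⟩
        ⟨some .row, some p, contents i r (p :: (q.reverse ++ o)) a b c d⟩ (q.length + 1) := by
  induction q with
  | nil =>
    intro v o _
    refine .step ?_
    simpa [program, contents, hp] using Runs.refl _
  | cons z q ih =>
    intro v o h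
    refine .step ?_
    have hz := h z (by simp)
    simpa [program, contents, hz] using ih (some z) (z :: o) fun y hy => h y (by simp [hy])

end loops

/-- From the reversed rows of the old matrix, the machine writes the rows of the copies where the
owner moves. -/
theorem runs_row {L : List (List Letter)} (n : ℕ)
    (hL : ∀ x ∈ L, ∃ p q, x = p :: q ∧ p.opensRow = true ∧ ∀ z ∈ q, z.opensRow = false) :
    ∀ v o, Runs ⟨some .row, v, contents [] L.flatten.reverse o n 0 0 0⟩
      ⟨some .minRow, none,
        contents [] [] ((L.flatMap fun x => x ++ (.replicate n .noEdge ++ [.noEdge])) ++ o) n 0 0 0⟩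
      (L.length * (2 * n + 3) + L.flatten.length + 1) := by
  induction L using List.reverseRecOn with
  | nil =>
    intro v o
    refine Runs.mono (.step ?_) (le_add_self)
    simpa [program, contents] using Runs.refl _
  | append_singleton L x ih =>
    intro v o
    obtain ⟨p, q, rfl, hp, hq⟩ := hL x (by simp)
    have h1 := runs_row₁ [] (L ++ [p :: q]).flatten.reverse (.noEdge :: o) n 0 0 0
      (L ++ [p :: q]).flatten.reverse.head?
    have h2 := runs_row₂ [] (L ++ [p :: q]).flatten.reverse (.replicate n .noEdge ++ .noEdge :: o)
      0 (0 + n) 0 0 none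
    have h3 := runs_rowCopy [] L.flatten.reverse (0 + (0 + n)) 0 0 0 hp (q := q.reverse) none
      (.replicate n .noEdge ++ .noEdge :: o) (by simpa using hq)
    have h4 := ih (fun x hx => hL x (by simp [hx])) (some p)
      (p :: (q ++ (.replicate n .noEdge ++ .noEdge :: o)))
    have h0 : Runs ⟨some .row, v, contents [] (L ++ [p :: q]).flatten.reverse o n 0 0 0⟩
        ⟨some .row₁, (L ++ [p :: q]).flatten.reverse.head?,
          contents [] (L ++ [p :: q]).flatten.reverse (.noEdge :: o) n 0 0 0⟩ 1 := by
      refine .step ?_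
      simpa [program, contents, write] using Runs.refl _
    simp only [List.flatten_append, List.flatten_cons, List.flatten_nil, List.append_nil,
      List.reverse_append, List.reverse_cons, List.append_assoc, zero_add,
      List.reverse_reverse, List.flatMap_append, List.flatMap_cons, List.flatMap_nil,
      List.cons_append, List.nil_append] at h0 h1 h2 h3 h4 ⊢
    refine ((((h0.trans h1).trans h2).trans h3).trans h4).mono ?_
    simp only [List.length_append, List.length_cons, List.length_nil, List.length_reverse]
    ring_nf
    omega

theorem stoppingRow_append (m k : ℕ) (o : List Letter) :
    stoppingRow (m + (k + 1)) m ++ o = .minVertex :: (.replicate m .noEdge ++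
      (.replicate k .noEdge ++ .noEdge :: (.replicate m .noEdge ++
        .plus :: (.replicate k .noEdge ++ .plus :: o)))) := by
  have h1 : m + (k + 1) - 1 - m = k := by omega
  have h2 : List.replicate (m + (k + 1)) Letter.noEdge =
      .replicate m .noEdge ++ (.replicate k .noEdge ++ [.noEdge]) := by
    rw [List.replicate_add, List.replicate_succ']
  simp only [stoppingRow, h1, h2, List.cons_append, List.append_assoc, List.nil_append]

/-- With `m` on the counter `a` and `k` on the counter `b`, the machine writes the rows of the first
`m` stopping copies. -/
theorem runs_minRow (m : ℕ) : ∀ v o k, Runs ⟨some .minRow, v, contents [] [] o m k 0 0⟩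
    ⟨some .clear, none,
      contents [] [] ((List.range m).flatMap (stoppingRow (m + k)) ++ o) 0 (k + m) 0 0⟩
    (m * (2 * (m + k) + 3) + 1) := by
  induction m with
  | zero =>
    intro v o k
    refine Runs.mono (.step ?_) (le_add_self)
    simpa [program, contents] using Runs.refl _
  | succ m ih =>
    intro v o k
    have h0 : Runs ⟨some .minRow, v, contents [] [] o (m + 1) k 0 0⟩
        ⟨some .minRow₁, some .noEdge, contents [] [] (.plus :: o) m k 0 0⟩ 1 := by
      refine .step ?_
      simpa [program, contents, write, head?_replicate_succ] using Runs.refl _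
    have h1 := h0.trans (runs_minRow₁ ..)
    have h2 := h1.trans (runs_minRow₂ ..)
    have h3 := h2.trans (runs_minRow₃ ..)
    have h4 := h3.trans (runs_minRow₄ ..)
    have h5 := h4.trans (by simpa only [zero_add] using ih ..)
    have hn : m + 1 + k = m + (k + 1) := by omega
    rw [hn, List.range_succ, List.flatMap_append, List.append_assoc, List.flatMap_singleton,
      stoppingRow_append, ← add_assoc k, add_right_comm k]
    refine h5.mono ?_
    ring_nf
    omega

theorem MPInstance.row_spec (I : MPInstance) (v : Fin I.n) : ∃ p q, I.row v = p :: q ∧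
    p.opensRow = true ∧ ∀ z ∈ q, z.opensRow = false := by
  refine ⟨_, _, rfl, by cases I.graph.owner v <;> rfl, fun z hz => ?_⟩
  obtain ⟨u, -, hz⟩ := List.mem_flatMap.1 hz
  obtain ⟨c, q, h1, -, -, h2⟩ := encodeEntry_eq_cons (I.graph.edge v u)
  rw [h1] at hz
  exact (h2 z hz).1

theorem MPInstance.runs_encode (I : MPInstance) :
    Runs ⟨some .tally, none, contents I.encode [] [] 0 0 0 0⟩
      ⟨none, none, contents [] [] I.toMCR.encode 0 0 0 0⟩ (11 * (I.encode.length + 1) ^ 2) := by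
  have hn : I.encode.countP Letter.opensRow = I.n := encodeGraph_size _ _
  have hle : I.n ≤ I.encode.length := hn ▸ List.countP_le_length
  have hflat : I.encode = ((List.finRange I.n).map I.row).flatten := by
    rw [I.encode_eq, List.flatMap_def]
  have h1 := runs_tally I.encode none [] 0
  have h2 := h1.trans (runs_target₁ ..)
  have h3 := h2.trans (runs_target₂ ..)
  rw [hn] at h3
  simp only [zero_add, List.append_nil] at h3
  have h4 := runs_row (L := (List.finRange I.n).map I.row) I.n
    (by simpa using I.row_spec) none (.minVertex :: .targetMark ::
      (.replicate I.n .noEdge ++ (.replicate I.n .noEdge ++ [.plus])))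
  rw [← hflat] at h4
  have h5 := (h3.trans h4).trans (runs_minRow ..)
  have h6 := h5.trans (runs_clear ..)
  rw [I.encode_toMCR]
  simp only [List.flatMap_map, List.length_map, List.length_finRange, add_zero,
    ← List.append_assoc] at h6 ⊢
  refine h6.mono ?_
  nlinarith

theorem polyTimeComputable_toMCR : PolyTimeComputable MPInstance.toMCR := by
  refine ⟨{
    tm := reductionMachine
    inputAlphabet := Equiv.refl Letter
    outputAlphabet := Equiv.refl Letter
    time := 11 * (Polynomial.X + 1) ^ 2
    outputsFun := fun I => Classical.choice ?_ }⟩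
  have hinit : ∀ w : List Letter, initList reductionMachine w =
      (⟨some .tally, none, contents w [] [] 0 0 0 0⟩ : Config) := fun w =>
    congrArg (TM2.Cfg.mk _ _) (funext fun k => by cases k <;> rfl)
  have hhalt : ∀ w : List Letter, haltList reductionMachine w =
      (⟨none, none, contents [] [] w 0 0 0 0⟩ : Config) := fun w =>
    congrArg (TM2.Cfg.mk _ _) (funext fun k => by cases k <;> rfl)
  have htime : (11 * (Polynomial.X + 1) ^ 2 : Polynomial ℕ).eval I.encode.length =
      11 * (I.encode.length + 1) ^ 2 := by simp
  have h := I.runs_encode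
  rw [← htime, ← hinit, ← hhalt] at h
  have h' : ∀ w w' : List Letter, w = I.encode → w' = I.toMCR.encode →
      Runs (initList reductionMachine w) (haltList reductionMachine w')
        ((11 * (Polynomial.X + 1) ^ 2 : Polynomial ℕ).eval I.encode.length) := by
    rintro _ _ rfl rfl
    exact h
  exact h' _ _ (List.map_id _) (List.map_id _)

end MCRGames

theorem mainTheorem2 :
    (∀ (V : Type*) [Finite V] (G : MCRGames.WeightedGraph V) (T : Set V),
      G.IsSink T → (∀ u, ¬ G.HasValue (G.mcrPayoff T) u ⊤) →
      ∀ v, ∃ x y : EReal, G.HasValue (G.mcrPayoff T) v x ∧ G.HasValue G.meanPayoff v y ∧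
        (x = ⊥ ↔ y < 0)) ∧
    ∃ f : MCRGames.MPInstance → MCRGames.MCRInstance, MCRGames.PolyTimeComputable f ∧
      ∀ I : MCRGames.MPInstance,
        (f I).graph.IsSink {(f I).target} ∧
        (∀ u, ¬ (f I).graph.HasValue ((f I).graph.mcrPayoff {(f I).target}) u ⊤) ∧
        ∃ h : I.n ≤ (f I).n, ∀ v : Fin I.n, ∃ x y : EReal,
          I.graph.HasValue I.graph.meanPayoff v x ∧
          (f I).graph.HasValue ((f I).graph.mcrPayoff {(f I).target}) (Fin.castLE h v) y ∧
          (x < 0 ↔ y = ⊥) := by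
  refine ⟨fun V _ G T hT htop v => G.exists_hasValue_eq_bot_iff T hT htop v,
    MCRGames.MPInstance.toMCR, MCRGames.polyTimeComputable_toMCR,
    fun I => ⟨I.toMCR_isSink, I.toMCR_not_hasValue_top, ?_⟩⟩
  have h : I.n ≤ I.toMCR.n := (Nat.le_add_right _ _).trans (Nat.le_succ _)
  exact ⟨h, I.exists_hasValue_toMCR h⟩
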